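/- Let $\lambda>-\tfrac12$, let $w_\lambda(t)=(1-t^2)^{\lambda-1/2}$ and $\|f\|_{w_\lambda}=\big(\int_{-1}^1 w_\lambda(t)f(t)^2\,dt\big)^{1/2}$, let $\mathcal P_n$ be the set of real algebraic polynomials of degree at most $n$, and let $$c_n(\lambda)=\sup_{p\in\mathcal P_n,\;p\neq0}\frac{\|p'\|_{w_\lambda}}{\|p\|_{w_\lambda}}$$ be the best constant in the Markov inequality $\|p'\|_{w_\lambda}\le c_n(\lambda)\|p\|_{w_\lambda}$, $p\in\mathcal P_n$. Let $h_i>0$ with $$h_i^2=\frac{\Gamma(i+2\lambda)}{(i+\lambda)\,\Gamma(i+1)},$$ and for $k\ge1$ put $$\alpha_k=(2k-1+\lambda)h_{2k-1},\quad \beta_k=\frac1{h_{2k}},\qquad \widetilde\alpha_k=(2k-2+\lambda)h_{2k-2},\quad \widetilde\beta_k=\frac1{h_{2k-1}},$$ where, for $\lambda=0$ and $k=1$, $\widetilde\alpha_1=\lambda h_0$ is read as $1/\sqrt2$ (the limit of $|\lambda h_0|=\sqrt{\Gamma(2\lambda+1)/2}$). For $m\ge 0$ let $\mathbf C_m$ be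 the upper triangular $m\times m$ matrix with entries $\alpha_i\beta_j$ for $1\le i\le j\le m$ and $0$ for $i>j$, let $\mathbf B_m=(\mathbf C_m\mathbf C_m^{\top})^{-1}$, and let $P_m(\mu)=\det(\mu\mathbf E_m-\mathbf B_m)$, where $\mathbf E_m$ is the identity matrix and $P_0=1$; define $\widetilde{\mathbf C}_m,\widetilde{\mathbf B}_m,\widetilde P_m$ in the same way from $\widetilde\alpha_k,\widetilde\beta_k$. **Theorem.** 1. For every $m\ge1$, the constants $c_{2m}(\lambda)$ and $c_{2m-1}(\lambda)$ are finite, the polynomials $P_m$ and $\widetilde P_m$ have smallest real zeros $\mu_1$ and $\widetilde\mu_1$, these are positive, and $$c_n(\lambda)=\begin{cases}\dfrac{2}{\sqrt{\mu_1}},& n=2m,\\[2mm] \dfrac{2}{\sqrt{\widetilde\mu_1}},& n=2m-1.\end{cases}$$ 2. For every $m$, the matrix $\mathbf C_m\mathbf C_m^\top$ is invertible, and its inverse $\mathbf B_m=(b_{i,j})$ is positive definite, symmetric and tridiagonal, with $$b_{1,1}=\frac1{\alpha_1^2\beta_1^2},\qquad b_{k,k}=\frac1{\alpha_k^2}\Big(\frac1{\beta_{k-1}^2}+\frac1{\beta_k^2}\Big)\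 (2\le k\le m),\qquad b_{k,k+1}=b_{k+1,k}=-\frac1{\alpha_k\alpha_{k+1}\beta_k^2}\ (1\le k\le m-1).$$ 3. For every $k\ge 0$ the polynomial $P_k$ is monic of degree $k$. The sequence $(P_k)_{k\ge0}$ satisfies $P_0(\mu)=1$, $P_1(\mu)=\mu-\dfrac1{\alpha_1^2\beta_1^2}$ and $$P_k(\mu)=\Big[\mu-\frac1{\alpha_k^2}\Big(\frac1{\beta_{k-1}^2}+\frac1{\beta_k^2}\Big)\Big]P_{k-1}(\mu)-\frac1{\alpha_{k-1}^2\alpha_k^2\beta_{k-1}^4}P_{k-2}(\mu),\qquad k\ge2.$$ There is a positive measure $\nu$ on $\mathbb R$ with all moments finite, supported in $[0,\infty)$, such that $\int P_jP_k\,d\nu=0$ for $j\ne k$ and $\int P_k^2\,d\nu>0$ for all $k$. 4. Statements 2 and 3 also hold for $\widetilde{\mathbf C}_m$, $\widetilde{\mathbf B}_m$, $\widetilde P_k$, with $\alpha$'s and $\beta$'s replaced by $\widetilde\alpha$'s and $\widetilde\beta$'s (and with another measure). -/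

import Mathlib

open Polynomial MeasureTheory
open scoped Matrix

namespace GegenbauerMarkov

noncomputable section

/-- The Gegenbauer weight `w_lam(t) = (1 - t^2)^(lam - 1/2)`. -/
def weight (lam t : ℝ) : ℝ := (1 - t ^ 2) ^ (lam - 1 / 2)

/-- The weighted `L_2` norm `(∫_{-1}^{1} w_lam(t) p(t)^2 dt)^(1/2)` of a real polynomial. -/
def wnorm (lam : ℝ) (p : ℝ[X]) : ℝ :=
  Real.sqrt (∫ t in (-1 : ℝ)..1, weight lam t * (p.eval t) ^ 2)

/-- All quotients `‖p'‖ / ‖p‖`, for `p ≠ 0` a real polynomial of degree at most `n`. -/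
def markovRatios (n : ℕ) (lam : ℝ) : Set ℝ :=
  {r | ∃ p : ℝ[X], p.natDegree ≤ n ∧ p ≠ 0 ∧ r = wnorm lam (derivative p) / wnorm lam p}

/-- The best constant `c_n(lam)` in the Markov inequality `‖p'‖ ≤ c ‖p‖`. -/
def markovConst (n : ℕ) (lam : ℝ) : ℝ := sSup (markovRatios n lam)

/-- `h_i`, the nonnegative root of `h_i^2 = Γ(i + 2 lam) / ((i + lam) Γ(i + 1))`. -/
def h (lam : ℝ) (i : ℕ) : ℝ :=
  Real.sqrt (Real.Gamma (i + 2 * lam) / ((i + lam) * Real.Gamma (i + 1)))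

/-- `α_k = (2k - 1 + lam) h_{2k-1}`, for `k ≥ 1`. -/
def alpha (lam : ℝ) (k : ℕ) : ℝ := (2 * (k : ℝ) - 1 + lam) * h lam (2 * k - 1)

/-- `β_k = 1 / h_{2k}`, for `k ≥ 1`. -/
def beta (lam : ℝ) (k : ℕ) : ℝ := 1 / h lam (2 * k)

/-- `α̃_k = (2k - 2 + lam) h_{2k-2}`, for `k ≥ 1`.
For `k = 1` this is `lam * h_0`, whose square is `lam Γ(2 lam) = Γ(2 lam + 1) / 2`; at `lam = 0`,
where `h_0` is infinite, the square is given its value `1 / 2` by continuity. -/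
def alphaTilde (lam : ℝ) (k : ℕ) : ℝ :=
  if lam = 0 ∧ k = 1 then 1 / Real.sqrt 2
  else (2 * (k : ℝ) - 2 + lam) * h lam (2 * k - 2)

/-- `β̃_k = 1 / h_{2k-1}`, for `k ≥ 1`. -/
def betaTilde (lam : ℝ) (k : ℕ) : ℝ := 1 / h lam (2 * k - 1)

/-- The upper triangular `m × m` matrix with entries `a_i b_j` for `1 ≤ i ≤ j ≤ m`
(sequences are indexed from `1`, rows and columns from `0`). -/
def matC (a b : ℕ → ℝ) (m : ℕ) : Matrix (Fin m) (Fin m) ℝ :=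
  Matrix.of fun i j => if i ≤ j then a (i + 1) * b (j + 1) else 0

/-- `A_m = C_m C_mᵀ`. -/
def matA (a b : ℕ → ℝ) (m : ℕ) : Matrix (Fin m) (Fin m) ℝ := matC a b m * (matC a b m)ᵀ

/-- `B_m = A_m⁻¹`. -/
def matB (a b : ℕ → ℝ) (m : ℕ) : Matrix (Fin m) (Fin m) ℝ := (matA a b m)⁻¹

/-- The symmetric tridiagonal `m × m` matrix with diagonal entries
`1 / (a_1^2 b_1^2)` and `(1 / a_k^2) (1 / b_{k-1}^2 + 1 / b_k^2)` for `2 ≤ k ≤ m`,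
and off-diagonal entries `-1 / (a_k a_{k+1} b_k^2)` at `(k, k+1)` and `(k+1, k)`. -/
def tridiag (a b : ℕ → ℝ) (m : ℕ) : Matrix (Fin m) (Fin m) ℝ :=
  Matrix.of fun i j =>
    if (i : ℕ) = j then
      if (i : ℕ) = 0 then 1 / (a 1 ^ 2 * b 1 ^ 2)
      else 1 / a (i + 1) ^ 2 * (1 / b i ^ 2 + 1 / b (i + 1) ^ 2)
    else if (j : ℕ) = i + 1 then -(1 / (a (i + 1) * a (j + 1) * b (i + 1) ^ 2))
    else if (i : ℕ) = j + 1 then -(1 / (a (i + 1) * a (j + 1) * b (j + 1) ^ 2))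
    else 0

/-- `P_m(μ) = det (μ E_m - B_m)`, the characteristic polynomial of `B_m`. -/
def polyP (a b : ℕ → ℝ) (m : ℕ) : ℝ[X] := (matB a b m).charpoly

/-- The three-term recurrence for a sequence of polynomials, with its initial conditions. -/
def SatisfiesRecurrence (a b : ℕ → ℝ) (P : ℕ → ℝ[X]) : Prop :=
  P 0 = 1 ∧
  P 1 = X - C (1 / (a 1 ^ 2 * b 1 ^ 2)) ∧
  ∀ k : ℕ, P (k + 2) =
    (X - C (1 / a (k + 2) ^ 2 * (1 / b (k + 1) ^ 2 + 1 / b (k + 2) ^ 2))) * P (k + 1)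
      - C (1 / (a (k + 1) ^ 2 * a (k + 2) ^ 2 * b (k + 1) ^ 4)) * P k

/-- `P` is a sequence of orthogonal polynomials with respect to one positive measure
on `[0, ∞)` that has finite moments of all orders. -/
def OrthogonalOnHalfLine (P : ℕ → ℝ[X]) : Prop :=
  ∃ ν : Measure ℝ, ν (Set.Iio 0) = 0 ∧
    (∀ q : ℝ[X], Integrable (fun x => q.eval x) ν) ∧
    (∀ j k : ℕ, j ≠ k → ∫ x, (P j).eval x * (P k).eval x ∂ν = 0) ∧
    ∀ k : ℕ, 0 < ∫ x, (P k).eval x ^ 2 ∂ν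

end

end GegenbauerMarkov

namespace GegenbauerMarkov

/-! Expand p in Gegenbauer polynomials G_n with G_n(1) = 1, and write γ_n for `gammaRatio lam n` and
d_n for `invNormSq lam n`. Two facts turn the problem into linear algebra: d_n ‖G_n‖² is independent
of n, and (γ_n G_n)' = 2 Σ d_k G_k over the k < n with n - k odd
(`gammaRatio_mul_derivative_gegen`). After normalization, differentiation splits into two blocks,
odd to even degrees and even to odd degrees. Their matrices are, up to signs of basis vectors, twice
the two matrices C of the theorem. They are triangular because the derivative sum is, and have
entries a_i b_j because its coefficients depend only on k. The norm of a block is 2/√μ, with μ the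
smallest eigenvalue of B = (C Cᵀ)⁻¹.

It remains to see which block wins: the one containing degree n. The Gram entries of the derivatives
are positive and grow when both degrees rise by one (`gram_entry_mono`). Raising degrees by one
embeds the losing block into the winning one, and entrywise domination of Gram matrices gives
domination of norms (`norm_le_of_gram_le`).

For the algebra of B: C has a bidiagonal inverse W, so B = WᵀW is positive definite and tridiagonal.
The B_m are the leading blocks of one infinite Jacobi matrix, which yields the recurrence. Moreover
P_k(B) sends the first basis vector to a nonzero multiple of the k-th, so the spectral measure of
B_{m+1} at that vector makes P_0, ..., P_m orthogonal. The spectra lie in a fixed compact interval,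
and a weak limit of these measures serves for all k. -/

/-! ### Bidiagonal inverse of C and tridiagonal form of B -/

/-- The inverse of `matC a b m`, an upper bidiagonal matrix. -/
noncomputable def matW (a b : ℕ → ℝ) (m : ℕ) : Matrix (Fin m) (Fin m) ℝ :=
  Matrix.of fun i j =>
    if (j : ℕ) = i then 1 / (b (i + 1) * a (i + 1))
    else if (j : ℕ) = i + 1 then -(1 / (b (i + 1) * a (i + 2))) else 0

theorem matW_mul_matC {a b : ℕ → ℝ} (ha : ∀ k, 1 ≤ k → a k ≠ 0) (hb : ∀ k, 1 ≤ k → b k ≠ 0)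
    (m : ℕ) : matW a b m * matC a b m = 1 := by
  ext i j
  have hai := ha (i + 1) (by omega)
  have hbi := hb (i + 1) (by omega)
  have hai' := ha (i + 2) (by omega)
  rw [Matrix.mul_apply]
  -- Only k = i and k = i + 1 contribute. Both terms equal b_j / b_i wherever column j of C is
  -- nonzero, so they cancel above the diagonal and leave 1 on it.
  have key : ∀ k : Fin m, matW a b m i k * matC a b m k j
      = (if k = i then (if i ≤ j then b (j + 1) / b (i + 1) else 0) else 0)
        - (if (k : ℕ) = i + 1 then (if (i : ℕ) + 1 ≤ j then b (j + 1) / b (i + 1) else 0)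
            else 0) := by
    intro k
    simp only [matW, matC, Matrix.of_apply]
    by_cases h1 : (k : ℕ) = i
    · have : k = i := Fin.ext h1
      subst this
      by_cases h2 : k ≤ j
      · simp [h2]; field_simp
      · simp [h2]
    · have h1' : k ≠ i := fun h => h1 (congrArg _ h)
      by_cases h3 : (k : ℕ) = i + 1
      · have h4 : (k ≤ j) ↔ ((i : ℕ) + 1 ≤ j) := by rw [← h3]; rfl
        by_cases h2 : (i : ℕ) + 1 ≤ j
        · simp [h1', h3, h4, h2]; field_simp
        · simp [h1', h3, h4, h2]
      · simp [h1, h1', h3]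
  rw [Finset.sum_congr rfl fun k _ => key k, Finset.sum_sub_distrib, Finset.sum_ite_eq' Finset.univ i]
  simp only [Finset.mem_univ, if_true]
  rw [Matrix.one_apply]
  rcases lt_trichotomy (i : ℕ) j with hij | hij | hij
  · have h1 : (i : ℕ) + 1 ≤ j := hij
    have h2 : i ≤ j := hij.le
    have hne : i ≠ j := fun h => hij.ne (congrArg _ h)
    rw [Finset.sum_eq_single (⟨i + 1, lt_of_le_of_lt h1 j.2⟩ : Fin m)]
    · simp [h1, h2, hne]
    · intro k _ hk
      rw [if_neg]
      exact fun h => hk (Fin.ext h)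
    · simp
  · have : i = j := Fin.ext hij
    subst this
    simp [hbi]
  · have h1 : ¬ (i : ℕ) + 1 ≤ j := by omega
    have h2 : ¬ i ≤ j := fun h => absurd (show (i : ℕ) ≤ j from h) (by omega)
    have hne : i ≠ j := fun h => hij.ne' (congrArg _ h)
    simp [h1, h2, hne]

theorem matC_mul_matW {a b : ℕ → ℝ} (ha : ∀ k, 1 ≤ k → a k ≠ 0) (hb : ∀ k, 1 ≤ k → b k ≠ 0)
    (m : ℕ) : matC a b m * matW a b m = 1 :=
  mul_eq_one_comm.mp (matW_mul_matC ha hb m)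

theorem matA_mul {a b : ℕ → ℝ} (ha : ∀ k, 1 ≤ k → a k ≠ 0) (hb : ∀ k, 1 ≤ k → b k ≠ 0)
    (m : ℕ) : matA a b m * ((matW a b m)ᵀ * matW a b m) = 1 := by
  have h1 : (matC a b m)ᵀ * (matW a b m)ᵀ = 1 := by
    rw [← Matrix.transpose_mul, matW_mul_matC ha hb, Matrix.transpose_one]
  calc matA a b m * ((matW a b m)ᵀ * matW a b m)
      = matC a b m * ((matC a b m)ᵀ * (matW a b m)ᵀ) * matW a b m := by
        simp only [matA, Matrix.mul_assoc]
    _ = 1 := by rw [h1, Matrix.mul_one, matC_mul_matW ha hb]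

theorem isUnit_det_matA {a b : ℕ → ℝ} (ha : ∀ k, 1 ≤ k → a k ≠ 0) (hb : ∀ k, 1 ≤ k → b k ≠ 0)
    (m : ℕ) : IsUnit (matA a b m).det :=
  Matrix.isUnit_det_of_right_inverse (matA_mul ha hb m)

theorem matB_eq {a b : ℕ → ℝ} (ha : ∀ k, 1 ≤ k → a k ≠ 0) (hb : ∀ k, 1 ≤ k → b k ≠ 0)
    (m : ℕ) : matB a b m = (matW a b m)ᵀ * matW a b m :=
  Matrix.inv_eq_right_inv (matA_mul ha hb m)

theorem matB_posDef {a b : ℕ → ℝ} (ha : ∀ k, 1 ≤ k → a k ≠ 0) (hb : ∀ k, 1 ≤ k → b k ≠ 0)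
    (m : ℕ) : (matB a b m).PosDef := by
  rw [matB_eq ha hb]
  have := Matrix.PosDef.conjTranspose_mul_self (matW a b m)
    (Matrix.mulVec_injective_of_isUnit
      (IsUnit.of_mul_eq_one _ (matW_mul_matC ha hb m)))
  simpa [Matrix.conjTranspose_eq_transpose_of_trivial] using this

theorem matB_eq_tridiag {a b : ℕ → ℝ} (ha : ∀ k, 1 ≤ k → a k ≠ 0) (hb : ∀ k, 1 ≤ k → b k ≠ 0)
    (m : ℕ) : matB a b m = tridiag a b m := by
  rw [matB_eq ha hb]
  ext i j
  rw [Matrix.mul_apply]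
  have hai := ha (i + 1) (by omega)
  have hbi := hb (i + 1) (by omega)
  have haj := ha (j + 1) (by omega)
  have hbj := hb (j + 1) (by omega)
  have key : ∀ k : Fin m, (matW a b m)ᵀ i k * matW a b m k j
      = (if k = i then 1 / (b (i + 1) * a (i + 1)) * matW a b m i j else 0)
        + (if (i : ℕ) = k + 1 then -(1 / (b (k + 1) * a (k + 2))) * matW a b m k j else 0) := by
    intro k
    rw [Matrix.transpose_apply]
    by_cases h1 : k = i
    · subst h1
      simp [matW]
    · have h1' : (i : ℕ) ≠ k := fun h => h1 (Fin.ext h.symm)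
      by_cases h2 : (i : ℕ) = k + 1
      · simp [matW, h1, h2]
      · simp [matW, h1, h1', h2]
  rw [Finset.sum_congr rfl fun k _ => key k, Finset.sum_add_distrib,
    Finset.sum_ite_eq' Finset.univ i]
  simp only [Finset.mem_univ, if_true]
  by_cases hi : (i : ℕ) = 0
  · have : ∀ k : Fin m, ¬ (i : ℕ) = k + 1 := fun k => by omega
    simp only [this, if_false, Finset.sum_const_zero, add_zero]
    simp only [matW, tridiag, Matrix.of_apply]
    by_cases h1 : (j : ℕ) = i
    · simp only [hi] at h1 ⊢
      simp only [hi, h1, zero_add] at *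
      simp
      field_simp
    · have h1' : ¬ (i : ℕ) = j := fun h => h1 h.symm
      have h2 : ¬ (i : ℕ) = j + 1 := by omega
      by_cases h3 : (j : ℕ) = i + 1
      · simp only [h3, if_true]
        have := ha (i + 2) (by omega)
        simp
        field_simp
      · simp [h1, h1', h2, h3]
  · obtain ⟨i', hi'⟩ : ∃ i', (i : ℕ) = i' + 1 := ⟨i - 1, by omega⟩
    have hbi' := hb (i' + 1) (by omega)
    have hai' := ha (i' + 1) (by omega)
    have hlt : i' < m := by omega
    rw [Finset.sum_eq_single (⟨i', hlt⟩ : Fin m)]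
    · simp only [matW, tridiag, Matrix.of_apply, hi', if_true]
      rw [hi'] at hai hbi
      by_cases h1 : (j : ℕ) = i' + 1
      · simp [h1]
        rw [h1] at haj hbj
        field_simp
        ring
      · have h1' : ¬ (i' + 1 = (j : ℕ)) := fun h => h1 h.symm
        by_cases h2 : (j : ℕ) = i' + 2
        · have h3 : ¬ (i' = (j : ℕ)) := by omega
          have := ha (i' + 3) (by omega)
          simp [h2]
          field_simp
        · by_cases h3 : (j : ℕ) = i'
          · have h4 : ¬ i' = i' + 1 + 1 := by omega
            simp [h3, h4]
            field_simp
          · have h3' : ¬ (i' = (j : ℕ)) := fun h => h3 h.symm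
            have h2' : ¬ (j : ℕ) = i' + 1 + 1 := h2
            simp [h1, h1', h2', h3, h3']
    · intro k _ hk
      rw [if_neg]
      intro h
      exact hk (Fin.ext (by simp; omega))
    · simp

/-! ### Characteristic polynomials and their recurrence -/

theorem polyP_monic (a b : ℕ → ℝ) (m : ℕ) : (polyP a b m).Monic := Matrix.charpoly_monic _

theorem polyP_natDegree (a b : ℕ → ℝ) (m : ℕ) : (polyP a b m).natDegree = m := by
  simp [polyP, Matrix.charpoly_natDegree_eq_dim]

/-- Laplace expansion along the last row, then along the last column of the off-diagonal minor. The
entries come from one array on ℕ × ℕ, so that matrices of different sizes are nested blocks. -/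
theorem det_tridiagonal_succ_succ {R : Type*} [CommRing R] (M : ℕ → ℕ → R)
    (hM : ∀ i j, i + 1 < j ∨ j + 1 < i → M i j = 0) (m : ℕ) :
    (Matrix.of fun i j : Fin (m + 2) => M i j).det
      = M (m + 1) (m + 1) * (Matrix.of fun i j : Fin (m + 1) => M i j).det
        - M m (m + 1) * M (m + 1) m * (Matrix.of fun i j : Fin m => M i j).det := by
  rw [Matrix.det_succ_row _ (Fin.last (m + 1)), Fin.sum_univ_castSucc, Fin.sum_univ_castSucc]
  have hz : ∀ j : Fin m, M (m + 1) j = 0 := fun j => hM _ _ (Or.inr (by omega))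
  have h1 : (Matrix.of fun i j : Fin (m + 2) => M i j).submatrix (Fin.last (m + 1)).succAbove
      (Fin.last (m + 1)).succAbove = Matrix.of fun i j : Fin (m + 1) => M i j := by
    ext i j
    simp
  have h2 : ((Matrix.of fun i j : Fin (m + 2) => M i j).submatrix (Fin.last (m + 1)).succAbove
      (Fin.last m).castSucc.succAbove).det
        = M m (m + 1) * (Matrix.of fun i j : Fin m => M i j).det := by
    rw [Matrix.det_succ_column _ (Fin.last m), Fin.sum_univ_castSucc]
    have hz' : ∀ i : Fin m, M i (m + 1) = 0 := fun i => hM _ _ (Or.inl (by omega))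
    have h3 : ((Matrix.of fun i j : Fin (m + 2) => M i j).submatrix (Fin.last (m + 1)).succAbove
        (Fin.last m).castSucc.succAbove).submatrix (Fin.last m).succAbove (Fin.last m).succAbove
        = Matrix.of fun i j : Fin m => M i j := by
      ext i j
      simp [Fin.succAbove_of_castSucc_lt, Fin.lt_def]
    rw [h3]
    simp [hz', ← two_mul, pow_mul]
  rw [h1, h2]
  have : ((-1 : R)) ^ (m + 1 + m) = -1 := Odd.neg_one_pow ⟨m, by ring⟩
  simp [hz, ← two_mul, pow_mul, this]
  ring

theorem polyP_recurrence {a b : ℕ → ℝ} (ha : ∀ k, 1 ≤ k → a k ≠ 0) (hb : ∀ k, 1 ≤ k → b k ≠ 0) :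
    SatisfiesRecurrence a b (polyP a b) := by
  let M : ℕ → ℕ → ℝ[X] := fun i j =>
    if i = j then
      X - C (if i = 0 then 1 / (a 1 ^ 2 * b 1 ^ 2)
      else 1 / a (i + 1) ^ 2 * (1 / b i ^ 2 + 1 / b (i + 1) ^ 2))
    else if j = i + 1 then C (1 / (a (i + 1) * a (j + 1) * b (i + 1) ^ 2))
    else if i = j + 1 then C (1 / (a (i + 1) * a (j + 1) * b (j + 1) ^ 2))
    else 0
  have hP : ∀ m, polyP a b m = (Matrix.of fun i j : Fin m => M i j).det := by
    intro m
    rw [polyP, matB_eq_tridiag ha hb, Matrix.charpoly]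
    congr 1
    ext1 i j
    rw [Matrix.charmatrix_apply, Matrix.diagonal_apply]
    simp only [tridiag, Matrix.of_apply, M]
    by_cases h1 : i = j
    · subst h1; simp
    · have h1' : ¬ (i : ℕ) = j := fun h => h1 (Fin.ext h)
      by_cases h2 : (j : ℕ) = i + 1
      · rw [if_neg h1, if_neg h1', if_neg h1', if_pos h2, if_pos h2]
        simp
      · by_cases h3 : (i : ℕ) = j + 1
        · rw [if_neg h1, if_neg h1', if_neg h1', if_neg h2, if_neg h2, if_pos h3, if_pos h3]
          simp
        · simp [h1, h1', h2, h3]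
  refine ⟨by simp [polyP], by simp [hP, M], fun k => ?_⟩
  rw [hP, hP, hP, det_tridiagonal_succ_succ M]
  · congr 1
    · simp [M]
    · congr 1
      simp only [M]
      rw [if_neg (show ¬ k = k + 1 by omega), if_pos True.intro,
        if_neg (show ¬ k + 1 = k by omega),
        if_neg (show ¬ k = k + 1 + 1 by omega), if_pos True.intro, ← C_mul]
      congr 1
      ring
  · intro i j hij
    simp only [M]
    rw [if_neg (by omega), if_neg (by omega), if_neg (by omega)]

/-! ### Smallest eigenvalue of B and the norm of C -/

theorem exists_orthogonal_diagonalization {n : Type*} [Fintype n] [DecidableEq n]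
    {A : Matrix n n ℝ} (hA : A.IsHermitian) :
    ∃ U : Matrix n n ℝ, U * Uᵀ = 1 ∧ A = U * Matrix.diagonal hA.eigenvalues * Uᵀ := by
  refine ⟨hA.eigenvectorUnitary, ?_, ?_⟩
  · have := Unitary.coe_mul_star_self hA.eigenvectorUnitary
    simpa [Matrix.star_eq_conjTranspose, Matrix.conjTranspose_eq_transpose_of_trivial] using this
  · have := hA.spectral_theorem
    rw [Unitary.conjStarAlgAut_apply] at this
    simpa [Matrix.star_eq_conjTranspose, Matrix.conjTranspose_eq_transpose_of_trivial] using this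

/-- With x = C t one has t ⬝ t = x ⬝ B x, so the inequality is the Rayleigh bound for the least
eigenvalue of B. Equality holds at t = W v for an eigenvector v. -/
theorem exists_least_root {a b : ℕ → ℝ} (ha : ∀ k, 1 ≤ k → a k ≠ 0) (hb : ∀ k, 1 ≤ k → b k ≠ 0)
    {m : ℕ} (hm : 1 ≤ m) :
    ∃ μ₁ : ℝ, IsLeast {x : ℝ | (polyP a b m).IsRoot x} μ₁ ∧ 0 < μ₁ ∧
      (∀ t : Fin m → ℝ, μ₁ * (matC a b m *ᵥ t ⬝ᵥ matC a b m *ᵥ t) ≤ t ⬝ᵥ t) ∧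
      ∃ t : Fin m → ℝ, t ≠ 0 ∧ μ₁ * (matC a b m *ᵥ t ⬝ᵥ matC a b m *ᵥ t) = t ⬝ᵥ t := by
  have hpd := matB_posDef ha hb m
  have hH := hpd.isHermitian
  have : Nonempty (Fin m) := ⟨⟨0, hm⟩⟩
  obtain ⟨i₀, hi₀⟩ := Finite.exists_min hH.eigenvalues
  have hroot : ∀ x, (polyP a b m).IsRoot x ↔ ∃ i, hH.eigenvalues i = x := by
    intro x
    rw [polyP, ← Matrix.mem_spectrum_iff_isRoot_charpoly, hH.spectrum_real_eq_range_eigenvalues]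
    rfl
  have hBW : ∀ x : Fin m → ℝ, x ⬝ᵥ matB a b m *ᵥ x = matW a b m *ᵥ x ⬝ᵥ matW a b m *ᵥ x := by
    intro x
    rw [matB_eq ha hb, ← Matrix.mulVec_mulVec, Matrix.dotProduct_mulVec, Matrix.vecMul_transpose]
  have hWC : ∀ t : Fin m → ℝ, matW a b m *ᵥ (matC a b m *ᵥ t) = t := fun t => by
    rw [Matrix.mulVec_mulVec, matW_mul_matC ha hb, Matrix.one_mulVec]
  have hCW : ∀ t : Fin m → ℝ, matC a b m *ᵥ (matW a b m *ᵥ t) = t := fun t => by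
    rw [Matrix.mulVec_mulVec, matC_mul_matW ha hb, Matrix.one_mulVec]
  refine ⟨hH.eigenvalues i₀, ⟨(hroot _).2 ⟨i₀, rfl⟩, fun x hx => ?_⟩, hpd.eigenvalues_pos i₀,
    fun t => ?_, ?_⟩
  · obtain ⟨i, rfl⟩ := (hroot x).1 hx
    exact hi₀ i
  · set x := matC a b m *ᵥ t with hx
    have h1 : t ⬝ᵥ t = x ⬝ᵥ matB a b m *ᵥ x := by rw [hBW, hx, hWC]
    rw [h1]
    have h2 : ∀ y : Fin m → ℝ, ∀ U : Matrix (Fin m) (Fin m) ℝ, U * Uᵀ = 1 →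
        (Uᵀ *ᵥ y) ⬝ᵥ (Uᵀ *ᵥ y) = y ⬝ᵥ y := by
      intro y U hU
      rw [Matrix.dotProduct_mulVec, Matrix.vecMul_transpose, Matrix.mulVec_mulVec, hU,
        Matrix.one_mulVec]
    obtain ⟨U, hU, hsp⟩ := exists_orthogonal_diagonalization hH
    generalize hH.eigenvalues = ev at hi₀ hsp ⊢
    have h3 : x ⬝ᵥ matB a b m *ᵥ x
        = (Uᵀ *ᵥ x) ⬝ᵥ (Matrix.diagonal ev *ᵥ (Uᵀ *ᵥ x)) := by
      rw [hsp, Matrix.mul_assoc, ← Matrix.mulVec_mulVec, Matrix.dotProduct_mulVec,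
        ← Matrix.mulVec_transpose, ← Matrix.mulVec_mulVec]
    rw [h3, ← h2 x U hU]
    simp only [dotProduct, Matrix.mulVec_diagonal, Finset.mul_sum]
    refine Finset.sum_le_sum fun i _ => ?_
    nlinarith [hi₀ i, mul_self_nonneg ((Uᵀ *ᵥ x) i)]
  · set v : Fin m → ℝ := (hH.eigenvectorBasis i₀).ofLp with hv
    have hv0 : v ≠ 0 := by
      have := hH.eigenvectorBasis.orthonormal.ne_zero i₀
      intro h
      exact this ((WithLp.ofLp_eq_zero 2).1 h)
    refine ⟨matW a b m *ᵥ v, fun h => hv0 ?_, ?_⟩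
    · rw [← hCW v, h, Matrix.mulVec_zero]
    · rw [hCW, ← hBW, hH.mulVec_eigenvectorBasis i₀, dotProduct_smul, smul_eq_mul]

/-! ### The orthogonality measure -/

theorem aeval_orthogonal_conj {n : Type*} [Fintype n] [DecidableEq n] {U : Matrix n n ℝ}
    (hU : U * Uᵀ = 1) (ev : n → ℝ) (q : ℝ[X]) :
    aeval (U * Matrix.diagonal ev * Uᵀ) q
      = U * Matrix.diagonal (fun i => q.eval (ev i)) * Uᵀ := by
  have hU' : Uᵀ * U = 1 := mul_eq_one_comm.mp hU
  induction q using Polynomial.induction_on' with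
  | add p q hp hq =>
    simp only [map_add, hp, hq, eval_add, ← Matrix.diagonal_add, Matrix.mul_add, Matrix.add_mul]
  | monomial k c =>
    have hpow : (U * Matrix.diagonal ev * Uᵀ) ^ k
        = U * Matrix.diagonal (fun i => ev i ^ k) * Uᵀ := by
      induction k with
      | zero => simp [hU]
      | succ k ih =>
        rw [pow_succ, ih]
        calc U * Matrix.diagonal (fun i => ev i ^ k) * Uᵀ * (U * Matrix.diagonal ev * Uᵀ)
            = U * Matrix.diagonal (fun i => ev i ^ k) * (Uᵀ * U) * Matrix.diagonal ev * Uᵀ := by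
              simp only [Matrix.mul_assoc]
          _ = _ := by
              rw [hU', Matrix.mul_one, Matrix.mul_assoc U, Matrix.diagonal_mul_diagonal]
              simp only [pow_succ]
    rw [aeval_monomial, hpow, Matrix.algebraMap_eq_diagonal, Pi.algebraMap_def,
      Algebra.algebraMap_self_apply]
    have : (fun i => (monomial k c).eval (ev i)) = c • fun i => ev i ^ k := by
      ext i; simp
    rw [this, Matrix.diagonal_smul]
    simp [← Matrix.smul_eq_diagonal_mul]

/-- The product of the first `k` off-diagonal entries of `tridiag a b`. -/
noncomputable def offDiagProd (a b : ℕ → ℝ) (k : ℕ) : ℝ :=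
  ∏ j ∈ Finset.range k, -(1 / (a (j + 1) * a (j + 2) * b (j + 1) ^ 2))

theorem offDiagProd_ne_zero {a b : ℕ → ℝ} (ha : ∀ k, 1 ≤ k → a k ≠ 0)
    (hb : ∀ k, 1 ≤ k → b k ≠ 0) (k : ℕ) : offDiagProd a b k ≠ 0 := by
  refine Finset.prod_ne_zero_iff.2 fun j _ => ?_
  have h1 := ha (j + 1) (by omega)
  have h2 := ha (j + 2) (by omega)
  have h3 := hb (j + 1) (by omega)
  exact neg_ne_zero.2 (one_div_ne_zero (by positivity))

/-- The polynomials `P_k` evaluated at `B` move the first basis vector to multiples of the others. -/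
theorem aeval_polyP_apply_zero {a b : ℕ → ℝ} (ha : ∀ k, 1 ≤ k → a k ≠ 0)
    (hb : ∀ k, 1 ≤ k → b k ≠ 0) (m : ℕ) (k : ℕ) (hk : k < m + 1) (i : Fin (m + 1)) :
    aeval (tridiag a b (m + 1)) (polyP a b k) i 0 = if (i : ℕ) = k then offDiagProd a b k else 0 := by
  obtain ⟨h0, h1, h2⟩ := polyP_recurrence ha hb
  set T := tridiag a b (m + 1) with hT
  induction k using Nat.strong_induction_on generalizing i with
  | _ k ih =>
    match k, ih, hk with
    | 0, _, _ =>
      rw [h0, map_one, Matrix.one_apply]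
      simp only [offDiagProd, Finset.prod_range_zero, Fin.ext_iff, Fin.val_zero]
    | 1, _, hk =>
      rw [h1, map_sub, aeval_X, aeval_C, Matrix.sub_apply, Matrix.algebraMap_matrix_apply]
      simp only [hT, tridiag, Matrix.of_apply, offDiagProd, Fin.ext_iff, Fin.val_zero]
      by_cases hi0 : (i : ℕ) = 0
      · simp [hi0]
      · by_cases hi1 : (i : ℕ) = 1
        · have hb1 := hb 1 le_rfl
          simp [hi1]
          ring_nf
          exact Or.inl trivial
        · simp [hi0, hi1]
    | k + 2, ih, hk =>
      have e1 := ih (k + 1) (by omega) (by omega)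
      have e0 := ih k (by omega) (by omega)
      rw [h2]
      generalize hd : 1 / a (k + 2) ^ 2 * (1 / b (k + 1) ^ 2 + 1 / b (k + 2) ^ 2) = d
      generalize ho : 1 / (a (k + 1) ^ 2 * a (k + 2) ^ 2 * b (k + 1) ^ 4) = o
      rw [map_sub, map_mul, map_mul, map_sub, aeval_X, aeval_C, aeval_C, sub_mul,
        Algebra.algebraMap_eq_smul_one, Algebra.algebraMap_eq_smul_one, smul_mul_assoc,
        smul_mul_assoc, one_mul, one_mul, Matrix.sub_apply, Matrix.sub_apply, Matrix.smul_apply,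
        Matrix.smul_apply, e1, e0, Matrix.mul_apply]
      simp only [e1]
      subst hd ho
      -- By induction P_{k+1}(B) e_0 is a multiple of e_{k+1}, so B acts on it through a single
      -- column with at most three entries. The other terms of the recurrence remove the entries in
      -- rows k + 1 and k.
      rw [Finset.sum_eq_single (⟨k + 1, by omega⟩ : Fin (m + 1))]
      · simp only [if_true, hT, tridiag, Matrix.of_apply, smul_eq_mul]
        have hc1 : offDiagProd a b (k + 1)
            = offDiagProd a b k * -(1 / (a (k + 1) * a (k + 2) * b (k + 1) ^ 2)) :=
          Finset.prod_range_succ _ _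
        have hc2 : offDiagProd a b (k + 2)
            = offDiagProd a b (k + 1) * -(1 / (a (k + 2) * a (k + 3) * b (k + 2) ^ 2)) :=
          Finset.prod_range_succ _ _
        have n1 := ha (k + 1) (by omega)
        have n2 := ha (k + 2) (by omega)
        have n3 := ha (k + 3) (by omega)
        have n4 := hb (k + 1) (by omega)
        have n5 := hb (k + 2) (by omega)
        generalize (i : ℕ) = i
        by_cases c2 : i = k + 2
        · subst c2
          rw [if_neg (by omega), if_neg (by omega), if_pos (by omega), if_neg (by omega),
            if_neg (by omega), if_pos rfl, hc2]
          ring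
        · by_cases c1 : i = k + 1
          · subst c1
            rw [if_pos rfl, if_neg (by omega), if_pos rfl, if_neg (by omega),
              if_neg (by omega)]
            ring
          · by_cases c0 : i = k
            · subst c0
              rw [if_neg (by omega), if_pos rfl, if_neg (by omega), if_pos rfl,
                if_neg (by omega), hc1]
              field_simp
              ring
            · rw [if_neg c1, if_neg (by omega), if_neg (by omega), if_neg c1, if_neg c0, if_neg c2]
              ring
      · intro j _ hj
        rw [if_neg (fun h => hj (Fin.ext h)), mul_zero]
      · simp

/-- The form is |W v|², each row of W has at most two nonzero entries, and (x - y)² ≤ 2x² + 2y². The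
bound is uniform in m, which confines all spectra to one compact interval. -/
theorem dotProduct_matB_mulVec_le {a b : ℕ → ℝ} (ha : ∀ k, 1 ≤ k → a k ≠ 0)
    (hb : ∀ k, 1 ≤ k → b k ≠ 0) {K : ℝ} (hK₁ : ∀ k, 1 ≤ k → (1 / (b k * a k)) ^ 2 ≤ K)
    (hK₂ : ∀ k, 1 ≤ k → (1 / (b k * a (k + 1))) ^ 2 ≤ K) (m : ℕ) (v : Fin m → ℝ) :
    v ⬝ᵥ matB a b m *ᵥ v ≤ 4 * K * (v ⬝ᵥ v) := by
  rw [matB_eq ha hb, ← Matrix.mulVec_mulVec, Matrix.dotProduct_mulVec, Matrix.vecMul_transpose]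
  -- Extension by zero lets the last row of W, which has a single entry, follow the same formula.
  set w : ℕ → ℝ := fun n => if h : n < m then v ⟨n, h⟩ else 0 with hw
  have hvw : ∀ i : Fin m, v i = w i := fun i => by simp [hw]
  have hW : ∀ i : Fin m, (matW a b m *ᵥ v) i
      = 1 / (b (i + 1) * a (i + 1)) * w i - 1 / (b (i + 1) * a (i + 2)) * w (i + 1) := by
    intro i
    rw [Matrix.mulVec, dotProduct]
    have : ∀ j : Fin m, matW a b m i j * v j
        = (fun j : ℕ => (if j = i then 1 / (b (i + 1) * a (i + 1)) * w i else 0)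
          - (if j = i + 1 then 1 / (b (i + 1) * a (i + 2)) * w (i + 1) else 0)) j := by
      intro j
      rw [hvw]
      simp only [matW, Matrix.of_apply]
      by_cases c1 : (j : ℕ) = i
      · simp [c1]
      · by_cases c2 : (j : ℕ) = i + 1
        · simp [c2]
        · simp [c1, c2]
    rw [Finset.sum_congr rfl fun j _ => this j,
      Fin.sum_univ_eq_sum_range (fun j : ℕ => (if j = i then 1 / (b (i + 1) * a (i + 1)) * w i else 0)
          - (if j = i + 1 then 1 / (b (i + 1) * a (i + 2)) * w (i + 1) else 0)) m,
      Finset.sum_sub_distrib, Finset.sum_ite_eq', Finset.sum_ite_eq', if_pos (Finset.mem_range.2 i.2)]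
    by_cases c : (i : ℕ) + 1 < m
    · rw [if_pos (Finset.mem_range.2 c)]
    · rw [if_neg (by simpa using c)]
      simp [hw, c]
  have hsum : v ⬝ᵥ v = ∑ n ∈ Finset.range m, w n ^ 2 := by
    rw [← Fin.sum_univ_eq_sum_range (fun n => w n ^ 2), dotProduct]
    exact Finset.sum_congr rfl fun i _ => by rw [hvw]; ring
  have hshift : ∑ n ∈ Finset.range m, w (n + 1) ^ 2 ≤ ∑ n ∈ Finset.range m, w n ^ 2 := by
    have h1 := Finset.sum_range_succ' (fun n => w n ^ 2) m
    have h2 := Finset.sum_range_succ (fun n => w n ^ 2) m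
    have h3 : w m = 0 := by simp [hw]
    rw [h3] at h2
    nlinarith [sq_nonneg (w 0)]
  have hle : (matW a b m *ᵥ v) ⬝ᵥ (matW a b m *ᵥ v)
      ≤ ∑ n ∈ Finset.range m, (2 * K * w n ^ 2 + 2 * K * w (n + 1) ^ 2) := by
    rw [← Fin.sum_univ_eq_sum_range (fun n => 2 * K * w n ^ 2 + 2 * K * w (n + 1) ^ 2), dotProduct]
    refine Finset.sum_le_sum fun i _ => ?_
    rw [hW]
    have k1 := mul_le_mul_of_nonneg_right (hK₁ (i + 1) (by omega)) (sq_nonneg (w i))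
    have k2 := mul_le_mul_of_nonneg_right (hK₂ (i + 1) (by omega)) (sq_nonneg (w (i + 1)))
    nlinarith [sq_nonneg (1 / (b (i + 1) * a (i + 1)) * w i
      + 1 / (b (i + 1) * a (i + 2)) * w (i + 1))]
  rw [Finset.sum_add_distrib, ← Finset.mul_sum, ← Finset.mul_sum] at hle
  have hK : 0 ≤ K := (sq_nonneg _).trans (hK₁ 1 le_rfl)
  rw [hsum]
  nlinarith

/-- The spectral measure of `B` at the first basis vector. -/
theorem exists_spectral_measure {a b : ℕ → ℝ} (ha : ∀ k, 1 ≤ k → a k ≠ 0)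
    (hb : ∀ k, 1 ≤ k → b k ≠ 0) {K : ℝ} (hK₁ : ∀ k, 1 ≤ k → (1 / (b k * a k)) ^ 2 ≤ K)
    (hK₂ : ∀ k, 1 ≤ k → (1 / (b k * a (k + 1))) ^ 2 ≤ K) (m : ℕ) :
    ∃ ν : ProbabilityMeasure (Set.Icc 0 (4 * K)), ∀ j k, j < m + 1 → k < m + 1 →
      ∫ x, (polyP a b j * polyP a b k).eval (x : ℝ) ∂(ν : Measure (Set.Icc 0 (4 * K)))
        = if j = k then offDiagProd a b k ^ 2 else 0 := by
  have hpd := matB_posDef ha hb (m + 1)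
  have hH := hpd.isHermitian
  obtain ⟨U, hU, hsp⟩ := exists_orthogonal_diagonalization hH
  have hev : ∀ i, hH.eigenvalues i ∈ Set.Icc 0 (4 * K) := by
    intro i
    refine ⟨(hpd.eigenvalues_pos i).le, ?_⟩
    set v : Fin (m + 1) → ℝ := (hH.eigenvectorBasis i).ofLp with hv
    have hv0 : v ≠ 0 := by
      intro h
      exact hH.eigenvectorBasis.orthonormal.ne_zero i ((WithLp.ofLp_eq_zero 2).1 h)
    have h1 := dotProduct_matB_mulVec_le ha hb hK₁ hK₂ (m + 1) v
    rw [hH.mulVec_eigenvectorBasis i, dotProduct_smul, smul_eq_mul] at h1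
    have h2 : 0 < v ⬝ᵥ v :=
      lt_of_le_of_ne (Finset.sum_nonneg fun i _ => mul_self_nonneg _)
        (Ne.symm (dotProduct_self_eq_zero.not.2 hv0))
    exact le_of_mul_le_mul_right h1 h2
  generalize hH.eigenvalues = ev at hev hsp
  have hrow : ∑ i, U 0 i ^ 2 = 1 := by
    have := congrFun (congrFun hU 0) 0
    rw [Matrix.mul_apply, Matrix.one_apply_eq] at this
    rw [← this]
    exact Finset.sum_congr rfl fun i _ => by rw [Matrix.transpose_apply]; ring
  -- An atom at each eigenvalue, weighted by the squared first coordinate of its eigenvector, so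
  -- that ∫ q dν = q(B)₀₀.
  let ν : Measure (Set.Icc 0 (4 * K)) :=
    ∑ i, ENNReal.ofReal (U 0 i ^ 2) • Measure.dirac (⟨ev i, hev i⟩ : Set.Icc 0 (4 * K))
  have hν : IsProbabilityMeasure ν := by
    constructor
    simp only [ν, Measure.coe_finsetSum, Finset.sum_apply, Measure.smul_apply, measure_univ,
      smul_eq_mul, mul_one]
    rw [← ENNReal.ofReal_sum_of_nonneg (fun i _ => sq_nonneg _), hrow, ENNReal.ofReal_one]
  have hint : ∀ q : ℝ[X], ∫ x, q.eval (x : ℝ) ∂ν = ∑ i, U 0 i ^ 2 * q.eval (ev i) := by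
    intro q
    have hc : Continuous fun x : Set.Icc 0 (4 * K) => q.eval (x : ℝ) :=
      q.continuous.comp continuous_subtype_val
    rw [integral_finsetSum_measure]
    · refine Finset.sum_congr rfl fun i _ => ?_
      rw [integral_smul_measure, integral_dirac, ENNReal.toReal_ofReal (sq_nonneg _), smul_eq_mul]
    · intro i _
      exact (integrable_dirac (by simp)).smul_measure ENNReal.ofReal_ne_top
  refine ⟨⟨ν, hν⟩, fun j k hj hk => ?_⟩
  have hentry : ∀ q : ℝ[X], ∑ i, U 0 i ^ 2 * q.eval (ev i)
      = aeval (matB a b (m + 1)) q 0 0 := by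
    intro q
    rw [hsp, aeval_orthogonal_conj hU, Matrix.mul_apply]
    refine Finset.sum_congr rfl fun i _ => ?_
    rw [Matrix.mul_diagonal, Matrix.transpose_apply]
    ring
  have hsymm : ∀ (q : ℝ[X]) (i l), aeval (matB a b (m + 1)) q i l
      = aeval (matB a b (m + 1)) q l i := by
    intro q i l
    have : (aeval (matB a b (m + 1)) q)ᵀ = aeval (matB a b (m + 1)) q := by
      rw [hsp, aeval_orthogonal_conj hU, Matrix.transpose_mul, Matrix.transpose_mul,
        Matrix.transpose_transpose, Matrix.diagonal_transpose, Matrix.mul_assoc]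
    conv_lhs => rw [← this]
    rfl
  change ∫ x, (polyP a b j * polyP a b k).eval (x : ℝ) ∂ν = _
  -- By symmetry of P_j(B), the entry (P_j P_k)(B)₀₀ is the inner product of P_j(B) e_0 and P_k(B)
  -- e_0.
  rw [hint, hentry, map_mul, Matrix.mul_apply]
  simp only [hsymm (polyP a b j) 0]
  rw [matB_eq_tridiag ha hb]
  simp only [aeval_polyP_apply_zero ha hb m j hj, aeval_polyP_apply_zero ha hb m k hk]
  rw [Finset.sum_eq_single (⟨k, hk⟩ : Fin (m + 1))]
  · by_cases h : k = j
    · simp [h, sq]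
    · simp [h, Ne.symm h]
  · intro i _ hi
    rw [if_neg (fun h : (i : ℕ) = k => hi (Fin.ext h)), mul_zero]
  · simp

/-- Probability measures on a compact interval form a compact space, so the spectral measures
converge along any ultrafilter. For fixed j, k the integral of P_j P_k is constant once m ≥ max j k,
hence is inherited by the limit. -/
theorem orthogonalOnHalfLine_polyP {a b : ℕ → ℝ} (ha : ∀ k, 1 ≤ k → a k ≠ 0)
    (hb : ∀ k, 1 ≤ k → b k ≠ 0) {K : ℝ} (hK₁ : ∀ k, 1 ≤ k → (1 / (b k * a k)) ^ 2 ≤ K)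
    (hK₂ : ∀ k, 1 ≤ k → (1 / (b k * a (k + 1))) ^ 2 ≤ K) :
    OrthogonalOnHalfLine (polyP a b) := by
  choose ν hν using exists_spectral_measure ha hb hK₁ hK₂
  let 𝒰 : Ultrafilter ℕ := Filter.hyperfilter ℕ
  let μ : ProbabilityMeasure (Set.Icc 0 (4 * K)) := (𝒰.map ν).lim
  have hlim : Filter.Tendsto ν 𝒰 (nhds μ) := (𝒰.map ν).le_nhds_lim
  have hcont : ∀ q : ℝ[X], Continuous fun x : Set.Icc 0 (4 * K) => q.eval (x : ℝ) :=
    fun q => q.continuous.comp continuous_subtype_val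
  have hμ : ∀ j k, ∫ x, (polyP a b j * polyP a b k).eval (x : ℝ) ∂(μ : Measure (Set.Icc 0 (4 * K)))
      = if j = k then offDiagProd a b k ^ 2 else 0 := by
    intro j k
    have h1 := ProbabilityMeasure.tendsto_iff_forall_integral_tendsto.1 hlim
      (BoundedContinuousFunction.mkOfCompact ⟨_, hcont (polyP a b j * polyP a b k)⟩)
    refine tendsto_nhds_unique h1 (tendsto_const_nhds.congr' ?_)
    have h2 : ∀ᶠ m in (𝒰 : Filter ℕ), max j k ≤ m :=
      (Filter.hyperfilter_le_cofinite.trans Nat.cofinite_eq_atTop.le) (Filter.eventually_ge_atTop _)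
    filter_upwards [h2] with m hm
    exact (hν m j k (by omega) (by omega)).symm
  have hmeas : MeasurableEmbedding (Subtype.val : Set.Icc 0 (4 * K) → ℝ) :=
    MeasurableEmbedding.subtype_coe measurableSet_Icc
  refine ⟨(μ : Measure (Set.Icc 0 (4 * K))).map Subtype.val, ?_, fun q => ?_, fun j k hjk => ?_, fun k => ?_⟩
  · rw [hmeas.map_apply]
    convert measure_empty (μ := (μ : Measure (Set.Icc 0 (4 * K))))
    ext x
    simpa using x.2.1
  · rw [hmeas.integrable_map_iff]
    exact (hcont q).integrable_of_hasCompactSupport (HasCompactSupport.of_compactSpace _)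
  · rw [hmeas.integral_map]
    simpa [hjk] using hμ j k
  · rw [hmeas.integral_map]
    have := hμ k k
    simp only [← sq, eval_pow, if_true] at this
    rw [this]
    have := offDiagProd_ne_zero ha hb k
    positivity

/-! ### Gegenbauer polynomials: algebraic identities -/

/-- The Gegenbauer polynomials, normalized to take the value `1` at `1`. -/
noncomputable def gegen (lam : ℝ) : ℕ → ℝ[X]
  | 0 => 1
  | 1 => X
  | n + 2 => C (1 / (n + 1 + 2 * lam)) *
      (C (2 * (n + 1 + lam)) * X * gegen lam (n + 1) - C ((n : ℝ) + 1) * gegen lam n)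

section

variable {lam : ℝ}

/-- The divisor n + 1 + 2 lam is positive for every admissible `lam`. Normalizing at 1 thus includes
`lam = 0`, where the classical polynomials of positive degree vanish. -/
theorem gegen_recurrence (hlam : -1 / 2 < lam) (n : ℕ) :
    C (n + 1 + 2 * lam) * gegen lam (n + 2)
      = C (2 * (n + 1 + lam)) * X * gegen lam (n + 1) - C ((n : ℝ) + 1) * gegen lam n := by
  have h : (n : ℝ) + 1 + 2 * lam ≠ 0 := by
    have : (0 : ℝ) ≤ n := n.cast_nonneg
    linarith
  rw [gegen, ← mul_assoc, ← C_mul, mul_one_div_cancel h, C_1, one_mul]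

/-- The two relations feed each other: differentiating the recurrence and using both at n gives the
first at n + 1, while the second at n + 1 is the first at n rewritten by the recurrence. -/
theorem gegen_derivative_aux (hlam : -1 / 2 < lam) (n : ℕ) :
    (1 - X ^ 2) * derivative (gegen lam (n + 1))
        = C ((n : ℝ) + 1) * (gegen lam n - X * gegen lam (n + 1)) ∧
    (1 - X ^ 2) * derivative (gegen lam n)
        = C (n + 2 * lam) * (X * gegen lam n - gegen lam (n + 1)) := by
  induction n with
  | zero => simp [gegen]; ring
  | succ n ih =>
    obtain ⟨ih1, ih2⟩ := ih
    have hrec := gegen_recurrence hlam n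
    have hne : C ((n : ℝ) + 1 + 2 * lam) ≠ 0 := by
      have : (0 : ℝ) ≤ n := n.cast_nonneg
      exact C_ne_zero.2 (by linarith)
    have hder := congrArg derivative hrec
    simp only [derivative_mul, derivative_sub, derivative_C, derivative_X, zero_mul, zero_add,
      mul_one] at hder
    constructor
    · apply mul_left_cancel₀ hne
      push_cast
      simp only [C_add, C_mul, C_1, map_natCast, C_ofNat] at *
      linear_combination (1 - X ^ 2) * hder + (2 * ((n : ℝ[X]) + 1 + C lam) * X) * ih1
        - ((n : ℝ[X]) + 1) * ih2 + ((n : ℝ[X]) + 2) * X * hrec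
    · push_cast
      simp only [C_add, C_mul, C_1, map_natCast, C_ofNat] at *
      linear_combination ih1 + hrec

theorem one_sub_X_sq_ne_zero : (1 - X ^ 2 : ℝ[X]) ≠ 0 := by
  intro h
  have := congrArg (eval 0) h
  simp at this

theorem one_sub_X_sq_mul_derivative_gegen (hlam : -1 / 2 < lam) (n : ℕ) :
    (1 - X ^ 2) * derivative (gegen lam (n + 1))
        = C ((n : ℝ) + 1) * (gegen lam n - X * gegen lam (n + 1)) :=
  (gegen_derivative_aux hlam n).1

theorem one_sub_X_sq_mul_derivative_gegen' (hlam : -1 / 2 < lam) (n : ℕ) :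
    (1 - X ^ 2) * derivative (gegen lam n)
        = C (n + 2 * lam) * (X * gegen lam n - gegen lam (n + 1)) :=
  (gegen_derivative_aux hlam n).2

/-- The Gegenbauer differential equation. -/
theorem gegen_ode (hlam : -1 / 2 < lam) (n : ℕ) :
    (1 - X ^ 2) * derivative (derivative (gegen lam n))
      - C (2 * lam + 1) * X * derivative (gegen lam n)
      = -C (n * (n + 2 * lam)) * gegen lam n := by
  cases n with
  | zero => simp [gegen]
  | succ n =>
    apply mul_left_cancel₀ one_sub_X_sq_ne_zero
    have h1 := one_sub_X_sq_mul_derivative_gegen hlam n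
    have h2 := one_sub_X_sq_mul_derivative_gegen' hlam n
    have hder := congrArg derivative h1
    simp only [derivative_mul, derivative_sub, derivative_C, derivative_X, zero_mul, zero_add,
      derivative_one, derivative_X_pow, zero_sub, one_mul] at hder
    push_cast at *
    simp only [C_add, C_mul, C_1, map_natCast, C_ofNat] at *
    simp only [pow_one] at hder
    linear_combination (1 - X ^ 2) * hder + ((n : ℝ[X]) + 1) * h2
      + ((2 : ℝ[X]) * X - (2 * C lam + 1) * X - ((n : ℝ[X]) + 1) * X) * h1

theorem derivative_gegen_succ_succ (hlam : -1 / 2 < lam) (n : ℕ) :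
    C ((n + 1 + 2 * lam) * (n + 2 * lam)) * derivative (gegen lam (n + 2))
      - C (((n : ℝ) + 2) * (n + 1)) * derivative (gegen lam n)
      = C (2 * (n + 1 + lam) * (n + 2) * (n + 2 * lam)) * gegen lam (n + 1) := by
  apply mul_left_cancel₀ one_sub_X_sq_ne_zero
  have h1 := one_sub_X_sq_mul_derivative_gegen hlam (n + 1)
  have h2 := one_sub_X_sq_mul_derivative_gegen' hlam n
  have h3 := gegen_recurrence hlam n
  push_cast at *
  simp only [C_add, C_mul, C_1, map_natCast, C_ofNat] at *
  linear_combination ((n : ℝ[X]) + 1 + 2 * C lam) * (n + 2 * C lam) * h1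
    - ((n : ℝ[X]) + 2) * (n + 1) * h2 - (n + 2) * (n + 2 * C lam) * X * h3

theorem natDegree_gegen_le (n : ℕ) : (gegen lam n).natDegree ≤ n := by
  induction n using Nat.strong_induction_on with
  | _ n ih =>
    match n, ih with
    | 0, _ => simp [gegen]
    | 1, _ => simp [gegen]
    | n + 2, ih =>
      have h1 := ih (n + 1) (by omega)
      have h2 := ih n (by omega)
      rw [gegen]
      refine (natDegree_C_mul_le _ _).trans ((natDegree_sub_le _ _).trans (max_le ?_ ?_))
      · rw [mul_assoc]
        refine (natDegree_C_mul_le _ _).trans (natDegree_mul_le.trans ?_)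
        rw [natDegree_X]
        omega
      · exact (natDegree_C_mul_le _ _).trans (by omega)

theorem coeff_gegen_pos (hlam : -1 / 2 < lam) (n : ℕ) : 0 < (gegen lam n).coeff n := by
  induction n using Nat.strong_induction_on with
  | _ n ih =>
    match n, ih with
    | 0, _ => simp [gegen]
    | 1, _ => simp [gegen]
    | n + 2, ih =>
      have h1 := ih (n + 1) (by omega)
      have h2 : (gegen lam n).coeff (n + 2) = 0 :=
        coeff_eq_zero_of_natDegree_lt (lt_of_le_of_lt (natDegree_gegen_le n) (by omega))
      have hn : (0 : ℝ) ≤ n := n.cast_nonneg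
      have e1 : 0 < (n : ℝ) + 1 + 2 * lam := by linarith
      have e2 : 0 < (n : ℝ) + 1 + lam := by linarith
      rw [gegen, coeff_C_mul, coeff_sub, mul_assoc, coeff_C_mul, coeff_X_mul, coeff_C_mul, h2]
      simp only [mul_zero, sub_zero]
      positivity

/-- Every polynomial of degree at most `n` is a combination of the first Gegenbauer polynomials. -/
theorem exists_eq_sum_gegen (hlam : -1 / 2 < lam) (N : ℕ) (p : ℝ[X]) (hp : p.natDegree ≤ N) :
    ∃ x : ℕ → ℝ, p = ∑ j ∈ Finset.range (N + 1), C (x j) * gegen lam j := by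
  induction N generalizing p with
  | zero =>
    refine ⟨fun _ => p.coeff 0, ?_⟩
    rw [eq_C_of_natDegree_le_zero hp]
    simp [gegen]
  | succ N ih =>
    set c := p.coeff (N + 1) / (gegen lam (N + 1)).coeff (N + 1) with hc
    have hpos := coeff_gegen_pos hlam (N + 1)
    obtain ⟨x, hx⟩ := ih (p - C c * gegen lam (N + 1)) (by
      rw [natDegree_le_iff_coeff_eq_zero]
      intro k hk
      rw [coeff_sub, coeff_C_mul]
      rcases eq_or_lt_of_le (Nat.succ_le_of_lt hk) with h | h
      · rw [← h, hc]
        simp only [Nat.succ_eq_add_one]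
        field_simp
        ring
      · rw [coeff_eq_zero_of_natDegree_lt (lt_of_le_of_lt hp h),
          coeff_eq_zero_of_natDegree_lt (lt_of_le_of_lt (natDegree_gegen_le _) h)]
        ring)
    refine ⟨fun j => if j = N + 1 then c else x j, ?_⟩
    rw [Finset.sum_range_succ]
    have : ∑ j ∈ Finset.range (N + 1), C (if j = N + 1 then c else x j) * gegen lam j
        = ∑ j ∈ Finset.range (N + 1), C (x j) * gegen lam j := by
      refine Finset.sum_congr rfl fun j hj => ?_
      rw [if_neg (by have := Finset.mem_range.1 hj; omega)]
    rw [this, ← hx]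
    simp

end

/-! ### Integration against the weight; orthogonality and norms -/

section Integral

theorem intervalIntegrable_weight {lam : ℝ} (hlam : -1 / 2 < lam) :
    IntervalIntegrable (weight lam) volume (-1) 1 := by
  have hfac : ∀ t : ℝ, t ∈ Set.Icc (-1 : ℝ) 1 →
      weight lam t = (1 + t) ^ (lam - 1 / 2) * (1 - t) ^ (lam - 1 / 2) := by
    intro t ht
    rw [weight, ← Real.mul_rpow (by linarith [ht.1]) (by linarith [ht.2])]
    congr 1
    ring
  have hbase : IntervalIntegrable (fun x : ℝ => x ^ (lam - 1 / 2)) volume 0 1 :=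
    intervalIntegral.intervalIntegrable_rpow' (by linarith)
  -- On [-1, 0] the only possible singularity is that of (1 + t)^(lam - 1/2), integrable because the
  -- exponent exceeds -1. The other half follows by evenness.
  have hleft : IntervalIntegrable (weight lam) volume (-1) 0 := by
    have h1 : IntervalIntegrable (fun t : ℝ => (1 + t) ^ (lam - 1 / 2)) volume (-1) 0 := by
      have := hbase.comp_add_left 1
      simpa using this
    have h2 : ContinuousOn (fun t : ℝ => (1 - t) ^ (lam - 1 / 2)) (Set.uIcc (-1) 0) := by
      intro t ht
      rw [Set.uIcc_of_le (by norm_num)] at ht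
      refine ContinuousAt.continuousWithinAt ?_
      exact ContinuousAt.rpow_const (by fun_prop) (Or.inl (by linarith [ht.2]))
    refine (h1.mul_continuousOn h2).congr ?_
    intro t ht
    rw [Set.uIoc_of_le (by norm_num)] at ht
    exact (hfac t ⟨ht.1.le, by linarith [ht.2]⟩).symm
  have hright : IntervalIntegrable (weight lam) volume 0 1 := by
    have := ((IntervalIntegrable.iff_comp_neg).1 hleft).symm
    have e : (fun x => weight lam (-x)) = weight lam := by
      ext x
      simp [weight]
    simpa only [e, neg_neg, neg_zero] using this
  exact hleft.trans hright

theorem intervalIntegrable_weight_mul {lam : ℝ} (hlam : -1 / 2 < lam) (p : ℝ[X]) :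
    IntervalIntegrable (fun t => weight lam t * p.eval t) volume (-1) 1 :=
  (intervalIntegrable_weight hlam).mul_continuousOn p.continuous.continuousOn

/-- Integration of a polynomial against the Gegenbauer weight. -/
noncomputable def wint {lam : ℝ} (hlam : -1 / 2 < lam) : ℝ[X] →ₗ[ℝ] ℝ where
  toFun p := ∫ t in (-1 : ℝ)..1, weight lam t * p.eval t
  map_add' p q := by
    rw [← intervalIntegral.integral_add (intervalIntegrable_weight_mul hlam p)
      (intervalIntegrable_weight_mul hlam q)]
    simp only [eval_add, mul_add]
  map_smul' c p := by
    simp only [eval_smul, smul_eq_mul, RingHom.id_apply]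
    rw [← intervalIntegral.integral_const_mul]
    congr 1
    ext t
    ring

variable {lam : ℝ} (hlam : -1 / 2 < lam)

theorem wnorm_eq (p : ℝ[X]) : wnorm lam p = Real.sqrt (wint hlam (p * p)) := by
  rw [wnorm, wint]
  simp [sq]

theorem wint_C_mul (c : ℝ) (p : ℝ[X]) : wint hlam (C c * p) = c * wint hlam p := by
  rw [← smul_eq_C_mul, map_smul, smul_eq_mul]

theorem wint_one_pos : 0 < wint hlam 1 := by
  refine intervalIntegral.intervalIntegral_pos_of_pos_on
    (intervalIntegrable_weight_mul hlam 1) (fun t ht => ?_) (by norm_num)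
  have : 0 < 1 - t ^ 2 := by nlinarith [ht.1, ht.2]
  simp only [weight, eval_one, mul_one]
  positivity

/-- The integrand is the derivative of (1 - t²)^(lam + 1/2) f, which vanishes at ±1 since the
exponent is positive. -/
theorem wint_integration_by_parts (f : ℝ[X]) :
    wint hlam ((1 - X ^ 2) * derivative f - C (2 * lam + 1) * X * f) = 0 := by
  have hexp : 0 < lam + 1 / 2 := by linarith
  have h := intervalIntegral.integral_eq_sub_of_hasDerivAt_of_le (a := -1) (b := 1)
    (f := fun t => (1 - t ^ 2) ^ (lam + 1 / 2) * f.eval t)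
    (f' := fun t => weight lam t *
      ((1 - X ^ 2) * derivative f - C (2 * lam + 1) * X * f).eval t) (by norm_num) ?_ ?_
    (intervalIntegrable_weight_mul hlam _)
  · simp only [one_pow, sub_self, neg_sq, Real.zero_rpow hexp.ne', zero_mul] at h
    exact h
  · refine ContinuousOn.mul ?_ f.continuous.continuousOn
    exact ContinuousOn.rpow_const (by fun_prop) fun t _ => Or.inr hexp.le
  · intro t ht
    have hpos : 0 < 1 - t ^ 2 := by nlinarith [ht.1, ht.2]
    have h1 : HasDerivAt (fun t : ℝ => 1 - t ^ 2) (-(2 * t)) t := by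
      simpa using (hasDerivAt_pow 2 t).const_sub 1
    have h2 := (h1.rpow_const (p := lam + 1 / 2) (Or.inl hpos.ne')).mul (f.hasDerivAt t)
    refine h2.congr_deriv ?_
    have e1 : lam + 1 / 2 - 1 = lam - 1 / 2 := by ring
    have e2 : (1 - t ^ 2) ^ (lam + 1 / 2) = (1 - t ^ 2) ^ (lam - 1 / 2) * (1 - t ^ 2) := by
      rw [← Real.rpow_add_one hpos.ne']
      congr 1
      ring
    simp only [weight, eval_sub, eval_mul, eval_one, eval_pow, eval_X, eval_C, e1, e2]
    ring

/-- The differential operator is symmetric for the weight, and its eigenvalues i(i + 2 lam) are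
distinct: their difference is (n - m)(n + m + 2 lam), with n + m ≥ 1. -/
theorem wint_gegen_mul_gegen {n m : ℕ} (hnm : n ≠ m) :
    wint hlam (gegen lam n * gegen lam m) = 0 := by
  have key : ∀ i j : ℕ, wint hlam ((1 - X ^ 2) * (derivative (gegen lam i) * derivative (gegen lam j)))
      = i * (i + 2 * lam) * wint hlam (gegen lam i * gegen lam j) := by
    intro i j
    have h := wint_integration_by_parts hlam (derivative (gegen lam i) * gegen lam j)
    have e : (1 - X ^ 2) * derivative (derivative (gegen lam i) * gegen lam j)
        - C (2 * lam + 1) * X * (derivative (gegen lam i) * gegen lam j)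
        = (1 - X ^ 2) * (derivative (gegen lam i) * derivative (gegen lam j))
          - C (i * (i + 2 * lam)) * (gegen lam i * gegen lam j) := by
      rw [derivative_mul]
      linear_combination gegen lam j * gegen_ode hlam i
    rw [e, map_sub, wint_C_mul] at h
    linarith
  have h1 := key n m
  have h2 := key m n
  rw [mul_comm (derivative (gegen lam m)), h1, mul_comm (gegen lam m)] at h2
  have h3 : ((n : ℝ) - m) * (n + m + 2 * lam) * wint hlam (gegen lam n * gegen lam m) = 0 := by
    linear_combination h2
  have h4 : (n : ℝ) - m ≠ 0 := sub_ne_zero.2 (Nat.cast_injective.ne hnm)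
  have h5 : (n : ℝ) + m + 2 * lam ≠ 0 := by
    have : (1 : ℝ) ≤ (n : ℝ) + m := by exact_mod_cast (show 1 ≤ n + m by omega)
    linarith
  simpa [h4, h5] using h3

theorem wint_gegen_one_sq : 2 * (1 + lam) * wint hlam (gegen lam 1 * gegen lam 1)
    = wint hlam (gegen lam 0 * gegen lam 0) := by
  have h := wint_integration_by_parts hlam X
  have e : (1 - X ^ 2) * derivative X - C (2 * lam + 1) * X * X
      = (gegen lam 0 * gegen lam 0) - C (2 * (1 + lam)) * (gegen lam 1 * gegen lam 1) := by
    simp only [gegen, derivative_X, C_mul, C_add, C_1, C_ofNat]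
    ring
  rw [e, map_sub, wint_C_mul] at h
  linarith

/-- The integral of x G_{n+1} G_{n+2} is computed twice, reducing x G_{n+1} and then x G_{n+2} by
the recurrence. -/
theorem wint_gegen_succ_succ_sq (n : ℕ) :
    (n + 1 + 2 * lam) * (n + 2 + lam) * wint hlam (gegen lam (n + 2) * gegen lam (n + 2))
      = (n + 1 + lam) * (n + 2) * wint hlam (gegen lam (n + 1) * gegen lam (n + 1)) := by
  have h1 : (n + 1 + 2 * lam) * wint hlam (gegen lam (n + 2) * gegen lam (n + 2))
      = 2 * (n + 1 + lam) * wint hlam (X * gegen lam (n + 1) * gegen lam (n + 2)) := by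
    have e : C (n + 1 + 2 * lam) * (gegen lam (n + 2) * gegen lam (n + 2))
        = C (2 * (n + 1 + lam)) * (X * gegen lam (n + 1) * gegen lam (n + 2))
          - C ((n : ℝ) + 1) * (gegen lam n * gegen lam (n + 2)) := by
      linear_combination gegen lam (n + 2) * gegen_recurrence hlam n
    have := congrArg (wint hlam) e
    rw [map_sub, wint_C_mul, wint_C_mul, wint_C_mul,
      wint_gegen_mul_gegen hlam (show n ≠ n + 2 by omega)] at this
    linarith
  have h2 : 2 * (n + 2 + lam) * wint hlam (X * gegen lam (n + 1) * gegen lam (n + 2))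
      = (n + 2) * wint hlam (gegen lam (n + 1) * gegen lam (n + 1)) := by
    have e : C (2 * (n + 2 + lam)) * (X * gegen lam (n + 1) * gegen lam (n + 2))
        = C (n + 2 + 2 * lam) * (gegen lam (n + 3) * gegen lam (n + 1))
          + C ((n : ℝ) + 2) * (gegen lam (n + 1) * gegen lam (n + 1)) := by
      have := gegen_recurrence hlam (n + 1)
      push_cast at this
      simp only [C_add, C_mul, C_1, map_natCast, C_ofNat] at *
      linear_combination -gegen lam (n + 1) * this
    have := congrArg (wint hlam) e
    rw [map_add, wint_C_mul, wint_C_mul, wint_C_mul,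
      wint_gegen_mul_gegen hlam (show n + 3 ≠ n + 1 by omega)] at this
    linarith
  linear_combination (n + 2 + lam) * h1 + (n + 1 + lam) * h2

end Integral

/-! ### Gamma factors, derivative expansion and Gram entries -/

/-- `Γ(n + 2 lam) / n!`. -/
noncomputable def gammaRatio (lam : ℝ) (n : ℕ) : ℝ :=
  Real.Gamma (n + 2 * lam) / Real.Gamma (n + 1)

/-- `(n + lam) Γ(n + 2 lam) / n!`, with the value at `n = 0` defined by continuity in `lam`. -/
noncomputable def invNormSq (lam : ℝ) (n : ℕ) : ℝ :=
  if n = 0 then Real.Gamma (1 + 2 * lam) / 2 else (n + lam) * gammaRatio lam n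

section

variable {lam : ℝ} (hlam : -1 / 2 < lam)

theorem gammaRatio_pos (hlam : -1 / 2 < lam) {n : ℕ} (hn : 1 ≤ n) : 0 < gammaRatio lam n := by
  have h1 : (1 : ℝ) ≤ n := by exact_mod_cast hn
  exact div_pos (Real.Gamma_pos_of_pos (by linarith)) (Real.Gamma_pos_of_pos (by linarith))

theorem gammaRatio_succ (hlam : -1 / 2 < lam) {n : ℕ} (hn : 1 ≤ n) :
    (n + 1) * gammaRatio lam (n + 1) = (n + 2 * lam) * gammaRatio lam n := by
  have h1 : (1 : ℝ) ≤ n := by exact_mod_cast hn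
  have e1 : Real.Gamma ((n : ℝ) + 1 + 2 * lam) = (n + 2 * lam) * Real.Gamma (n + 2 * lam) := by
    rw [← Real.Gamma_add_one (by linarith)]
    congr 1
    ring
  have e2 : Real.Gamma ((n : ℝ) + 1 + 1) = (n + 1) * Real.Gamma (n + 1) :=
    Real.Gamma_add_one (by linarith)
  have h2 : 0 < Real.Gamma ((n : ℝ) + 1) := Real.Gamma_pos_of_pos (by linarith)
  rw [gammaRatio, gammaRatio]
  push_cast
  rw [e1, e2]
  field_simp

theorem invNormSq_of_pos {n : ℕ} (hn : 1 ≤ n) : invNormSq lam n = (n + lam) * gammaRatio lam n := by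
  rw [invNormSq, if_neg (by omega)]

theorem invNormSq_zero : invNormSq lam 0 = gammaRatio lam 1 / 2 := by
  rw [invNormSq, if_pos rfl, gammaRatio]
  norm_num [Real.Gamma_two]

theorem invNormSq_pos (hlam : -1 / 2 < lam) (n : ℕ) : 0 < invNormSq lam n := by
  rcases Nat.eq_zero_or_pos n with rfl | hn
  · rw [invNormSq_zero]
    exact half_pos (gammaRatio_pos hlam le_rfl)
  · rw [invNormSq_of_pos hn]
    have h1 : (1 : ℝ) ≤ n := by exact_mod_cast hn
    exact mul_pos (by linarith) (gammaRatio_pos hlam hn)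

/-- This is the telescoping step of the derivative expansion. It starts at n = 1 because `gammaRatio
lam 0` involves Γ(2 lam), which has a pole at `lam = 0`; degrees 1 and 2 are therefore separate base
cases. -/
theorem gammaRatio_mul_derivative_gegen_succ_succ (hlam : -1 / 2 < lam) {n : ℕ} (hn : 1 ≤ n) :
    C (gammaRatio lam (n + 2)) * derivative (gegen lam (n + 2))
      = C (gammaRatio lam n) * derivative (gegen lam n)
        + C (2 * invNormSq lam (n + 1)) * gegen lam (n + 1) := by
  have h := derivative_gegen_succ_succ hlam n
  have e1 := gammaRatio_succ hlam hn
  have e2 := gammaRatio_succ hlam (show 1 ≤ n + 1 by omega)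
  have hn0 : (0 : ℝ) ≤ n := n.cast_nonneg
  have hne : C (((n : ℝ) + 2) * (n + 1)) ≠ 0 := C_ne_zero.2 (by positivity)
  rw [invNormSq_of_pos (by omega)]
  apply mul_left_cancel₀ hne
  push_cast at *
  have f1 := congrArg C e1
  have f2 := congrArg C e2
  have f3 : C (((n : ℝ) + 1) * (n + 2) * gammaRatio lam (n + 2))
      = C ((n + 2 * lam) * (n + 1 + 2 * lam) * gammaRatio lam n) := by
    congr 1
    linear_combination (n + 1) * e2 + (n + 1 + 2 * lam) * e1
  simp only [C_add, C_mul, C_1, map_natCast, C_ofNat] at *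
  linear_combination C (gammaRatio lam n) * h + derivative (gegen lam (n + 2)) * f3
    - (2 * ((n : ℝ[X]) + 1 + C lam) * (n + 2)) * gegen lam (n + 1) * f1

theorem gammaRatio_mul_derivative_gegen_one :
    C (gammaRatio lam 1) * derivative (gegen lam 1) = C (2 * invNormSq lam 0) * gegen lam 0 := by
  rw [invNormSq_zero, mul_div_cancel₀ _ two_ne_zero]
  simp [gegen]

theorem gammaRatio_mul_derivative_gegen_two (hlam : -1 / 2 < lam) :
    C (gammaRatio lam 2) * derivative (gegen lam 2) = C (2 * invNormSq lam 1) * gegen lam 1 := by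
  have e := gammaRatio_succ hlam (le_refl 1)
  have hne : 1 + 2 * lam ≠ 0 := by linarith
  rw [invNormSq_of_pos le_rfl]
  have e' : gammaRatio lam 2 = (1 + 2 * lam) / 2 * gammaRatio lam 1 := by
    push_cast at e
    norm_num at e
    linarith
  rw [e']
  have : gegen lam 2 = C (1 / (1 + 2 * lam)) * (C (2 * (1 + lam)) * X * X - 1) := by
    simp [gegen]
  rw [this]
  simp only [gegen, derivative_mul, derivative_C, derivative_X, derivative_sub, derivative_one,
    zero_mul, zero_add, sub_zero, mul_one]
  have : C ((1 + 2 * lam) / 2 * gammaRatio lam 1) * (C (1 / (1 + 2 * lam)) * C (2 * (1 + lam)))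
      = C ((1 + lam) * gammaRatio lam 1) := by
    rw [← C_mul, ← C_mul]
    congr 1
    field_simp
  have h2 : C (2 * (((1 : ℕ) : ℝ) + lam) * gammaRatio lam 1)
      = 2 * C ((1 + lam) * gammaRatio lam 1) := by
    rw [← C_ofNat, ← C_mul]
    congr 1
    push_cast
    ring
  rw [← mul_assoc 2, h2]
  linear_combination 2 * X * this

theorem gammaRatio_mul_derivative_gegen (hlam : -1 / 2 < lam) (r : ℕ) (hr : r ≤ 1) (l : ℕ) :
    C (gammaRatio lam (2 * l + 1 + r)) * derivative (gegen lam (2 * l + 1 + r))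
      = ∑ k ∈ Finset.range (l + 1), C (2 * invNormSq lam (2 * k + r)) * gegen lam (2 * k + r) := by
  induction l with
  | zero =>
    interval_cases r
    · simpa using gammaRatio_mul_derivative_gegen_one
    · simpa using gammaRatio_mul_derivative_gegen_two hlam
  | succ l ih =>
    rw [Finset.sum_range_succ, ← ih]
    have := gammaRatio_mul_derivative_gegen_succ_succ hlam (show 1 ≤ 2 * l + 1 + r by omega)
    convert this using 3 <;> first | rfl | ring_nf

theorem invNormSq_mul_wint_gegen_sq (n : ℕ) :
    invNormSq lam n * wint hlam (gegen lam n * gegen lam n)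
      = invNormSq lam 0 * wint hlam (gegen lam 0 * gegen lam 0) := by
  induction n with
  | zero => rfl
  | succ n ih =>
    rw [← ih]
    rcases Nat.eq_zero_or_pos n with rfl | hn
    · rw [invNormSq_zero, ← wint_gegen_one_sq hlam, invNormSq_of_pos (by omega)]
      push_cast
      ring
    · obtain ⟨n, rfl⟩ : ∃ k, n = k + 1 := ⟨n - 1, by omega⟩
      have h1 := wint_gegen_succ_succ_sq hlam n
      have h2 := gammaRatio_succ hlam hn
      rw [invNormSq_of_pos (by omega), invNormSq_of_pos (by omega)]
      have hn2 : (n : ℝ) + 2 ≠ 0 := by positivity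
      apply mul_left_cancel₀ hn2
      push_cast at *
      generalize gammaRatio lam (n + 1 + 1) = d2 at *
      generalize gammaRatio lam (n + 1) = d1 at *
      have e : (n : ℝ) + 1 + 1 = n + 2 := by ring
      rw [e] at *
      linear_combination (n + 2 + lam) * wint hlam (gegen lam (n + 2) * gegen lam (n + 2)) * h2
        + d1 * h1

theorem h_sq (hlam : -1 / 2 < lam) {n : ℕ} (hn : 1 ≤ n) :
    0 < h lam n ∧ h lam n ^ 2 = gammaRatio lam n / (n + lam) := by
  have h1 : (1 : ℝ) ≤ n := by exact_mod_cast hn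
  have h2 : Real.Gamma (n + 2 * lam) / ((n + lam) * Real.Gamma (n + 1))
      = gammaRatio lam n / (n + lam) := by
    rw [gammaRatio, div_div, mul_comm ((n : ℝ) + lam)]
  have h3 : 0 < gammaRatio lam n / (n + lam) := div_pos (gammaRatio_pos hlam hn) (by linarith)
  rw [h, h2]
  exact ⟨Real.sqrt_pos.2 h3, Real.sq_sqrt h3.le⟩

theorem add_mul_h_sq (hlam : -1 / 2 < lam) {n : ℕ} (hn : 1 ≤ n) :
    ((n + lam) * h lam n) ^ 2 = invNormSq lam n := by
  have h1 : (1 : ℝ) ≤ n := by exact_mod_cast hn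
  have h2 : (n : ℝ) + lam ≠ 0 := by linarith
  rw [mul_pow, (h_sq hlam hn).2, invNormSq_of_pos hn]
  field_simp

theorem alpha_succ_sq (hlam : -1 / 2 < lam) (k : ℕ) :
    alpha lam (k + 1) ^ 2 = invNormSq lam (2 * k + 1) := by
  rw [← add_mul_h_sq hlam (by omega), alpha]
  congr 2
  push_cast
  ring

/-- Only squares of the α's matter for the norms, so the negative sign of lam h_0 for `lam < 0` is
harmless, and the value prescribed at `lam = 0` fits the same formula. -/
theorem alphaTilde_succ_sq (hlam : -1 / 2 < lam) (k : ℕ) :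
    alphaTilde lam (k + 1) ^ 2 = invNormSq lam (2 * k) := by
  rcases Nat.eq_zero_or_pos k with rfl | hk
  · by_cases h0 : lam = 0
    · simp [alphaTilde, h0, invNormSq]
    · have e : Real.Gamma (1 + 2 * lam) = 2 * lam * Real.Gamma (2 * lam) := by
        rw [add_comm, Real.Gamma_add_one (by simpa using h0)]
      have hpos : 0 < Real.Gamma (1 + 2 * lam) := Real.Gamma_pos_of_pos (by linarith)
      have e2 : Real.Gamma (2 * lam) / lam = Real.Gamma (1 + 2 * lam) / (2 * lam ^ 2) := by
        rw [e]
        field_simp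
      have e3 : 0 ≤ Real.Gamma (2 * lam) / lam := by
        rw [e2]
        positivity
      simp only [alphaTilde, h0, h, invNormSq, false_and, if_false, if_true]
      norm_num
      rw [mul_pow, Real.sq_sqrt e3, e2]
      field_simp
  · rw [← add_mul_h_sq hlam (by omega), alphaTilde, if_neg (by omega)]
    congr 2
    push_cast
    ring

theorem sq_gammaRatio_div_h (hlam : -1 / 2 < lam) {n : ℕ} (hn : 1 ≤ n) :
    (gammaRatio lam n * (1 / h lam n)) ^ 2 = invNormSq lam n := by
  have h1 : (1 : ℝ) ≤ n := by exact_mod_cast hn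
  have h2 : (n : ℝ) + lam ≠ 0 := by linarith
  have h3 := gammaRatio_pos hlam hn
  rw [mul_pow, div_pow, (h_sq hlam hn).2, invNormSq_of_pos hn]
  field_simp

/-- The sum of `invNormSq lam i` over `i < n` with `n - i` odd, for `n ≥ 1`. -/
noncomputable def partialSum (lam : ℝ) (n : ℕ) : ℝ :=
  n * (n + 2 * lam) * gammaRatio lam n / (2 * (2 * lam + 1))

/-- The sum telescopes. The closed form makes ratios of consecutive sums rational in n, which the
monotonicity of the Gram entries relies on. -/
theorem sum_invNormSq (hlam : -1 / 2 < lam) (r : ℕ) (hr : r ≤ 1) (l : ℕ) :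
    ∑ k ∈ Finset.range (l + 1), invNormSq lam (2 * k + r) = partialSum lam (2 * l + 1 + r) := by
  have hne : 2 * lam + 1 ≠ 0 := by linarith
  induction l with
  | zero =>
    interval_cases r
    · simp [invNormSq_zero, partialSum]
      field_simp
      ring
    · have := gammaRatio_succ hlam (le_refl 1)
      rw [Finset.sum_range_one]
      change invNormSq lam 1 = partialSum lam 2
      rw [invNormSq_of_pos le_rfl, partialSum, eq_div_iff (mul_ne_zero two_ne_zero hne)]
      push_cast at this ⊢
      norm_num at this
      linear_combination -2 * (1 + lam) * this
  | succ l ih =>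
    rw [Finset.sum_range_succ, ih]
    have e1 : 2 * (l + 1) + r = 2 * l + 1 + r + 1 := by ring
    have e2 : 2 * (l + 1) + 1 + r = 2 * l + 1 + r + 1 + 1 := by ring
    rw [e1, e2]
    have hn : 1 ≤ 2 * l + 1 + r := by omega
    generalize 2 * l + 1 + r = n at *
    have h1 := gammaRatio_succ hlam hn
    have h2 := gammaRatio_succ hlam (show 1 ≤ n + 1 by omega)
    rw [invNormSq_of_pos (by omega), partialSum, partialSum]
    push_cast at *
    field_simp
    linear_combination -(n : ℝ) * h1 - (n + 2 + 2 * lam) * h2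

theorem partialSum_pos (hlam : -1 / 2 < lam) {n : ℕ} (hn : 1 ≤ n) : 0 < partialSum lam n := by
  have h1 : (1 : ℝ) ≤ n := by exact_mod_cast hn
  have h2 := gammaRatio_pos hlam hn
  have h3 : 0 < (n : ℝ) + 2 * lam := by linarith
  have h4 : 0 < 2 * lam + 1 := by linarith
  unfold partialSum
  positivity

theorem partialSum_succ (hlam : -1 / 2 < lam) {n : ℕ} (hn : 1 ≤ n) :
    n * partialSum lam (n + 1) = (n + 1 + 2 * lam) * partialSum lam n := by
  have h1 := gammaRatio_succ hlam hn
  have hne : 2 * lam + 1 ≠ 0 := by linarith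
  rw [partialSum, partialSum]
  push_cast at *
  field_simp
  linear_combination (n + 1 + 2 * lam) * h1

/-- The ratio of consecutive values of `h lam n ^ 2`. -/
theorem h_sq_succ (hlam : -1 / 2 < lam) {n : ℕ} (hn : 1 ≤ n) :
    h lam n ^ 2 = (n + 1) / (n + lam) * ((n + 1 + lam) / (n + 2 * lam)) * h lam (n + 1) ^ 2 := by
  have h0 : (1 : ℝ) ≤ n := by exact_mod_cast hn
  have h1 := gammaRatio_succ hlam hn
  have e1 : (n : ℝ) + lam ≠ 0 := by linarith
  have e2 : (n : ℝ) + 1 + lam ≠ 0 := by linarith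
  have e3 : (n : ℝ) + 2 * lam ≠ 0 := by linarith
  rw [(h_sq hlam hn).2, (h_sq hlam (show 1 ≤ n + 1 by omega)).2]
  have e4 : gammaRatio lam n = (n + 1) * gammaRatio lam (n + 1) / (n + 2 * lam) := by
    rw [eq_div_iff e3, h1, mul_comm]
  rw [e4]
  push_cast
  field_simp

/-- The entries of the Gram matrix of the derivatives of the orthonormal Gegenbauer polynomials
increase along the diagonals. -/
theorem gram_entry_mono (hlam : -1 / 2 < lam) {j l : ℕ} (hj : 1 ≤ j) (hjl : j ≤ l) :
    1 / h lam j * (1 / h lam l) * partialSum lam j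
      ≤ 1 / h lam (j + 1) * (1 / h lam (l + 1)) * partialSum lam (j + 1) := by
  have hl : 1 ≤ l := hj.trans hjl
  have hj' : (1 : ℝ) ≤ j := by exact_mod_cast hj
  have hjl' : (j : ℝ) ≤ l := by exact_mod_cast hjl
  obtain ⟨pj, -⟩ := h_sq hlam hj
  obtain ⟨pl, -⟩ := h_sq hlam hl
  obtain ⟨pj', -⟩ := h_sq hlam (show 1 ≤ j + 1 by omega)
  obtain ⟨pl', -⟩ := h_sq hlam (show 1 ≤ l + 1 by omega)
  have rj := h_sq_succ hlam hj
  have rl := h_sq_succ hlam hl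
  have hS := partialSum_pos hlam hj
  have hS' := partialSum_pos hlam (show 1 ≤ j + 1 by omega)
  have hq : partialSum lam (j + 1) = (j + 1 + 2 * lam) / j * partialSum lam j := by
    rw [div_mul_eq_mul_div, eq_div_iff (by positivity), ← partialSum_succ hlam hj, mul_comm]
  -- Here u and v are the ratios of h² at j and l, and q is the ratio of partial sums, so the
  -- squared quotient of the two entries is u v q².
  set u := ((j : ℝ) + 1) / (j + lam) * ((j + 1 + lam) / (j + 2 * lam)) with hu
  set v := ((l : ℝ) + 1) / (l + lam) * ((l + 1 + lam) / (l + 2 * lam)) with hv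
  set q := ((j : ℝ) + 1 + 2 * lam) / j with hqdef
  have f1 : 0 < (j : ℝ) + lam := by linarith
  have f2 : 0 < (j : ℝ) + 2 * lam := by linarith
  have f3 : 0 < (l : ℝ) + lam := by linarith
  have f4 : 0 < (l : ℝ) + 2 * lam := by linarith
  have f5 : 0 < (j : ℝ) + 1 + 2 * lam := by linarith
  have hq1 : 1 ≤ q := by
    rw [hqdef, le_div_iff₀ (by linarith)]
    linarith
  have hu0 : 0 < u := by
    have : 0 < (j : ℝ) + 1 + lam := by linarith
    positivity
  have hfac : ∀ n : ℕ, 1 ≤ n → lam ≤ 1 →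
      1 ≤ ((n : ℝ) + 1) / (n + lam) * ((n + 1 + lam) / (n + 2 * lam)) := by
    intro n hn h1
    have : (1 : ℝ) ≤ n := by exact_mod_cast hn
    refine one_le_mul_of_one_le_of_one_le ?_ ?_
    · rw [le_div_iff₀ (by linarith)]; linarith
    · rw [le_div_iff₀ (by linarith)]; linarith
  -- For `lam ≤ 1` all factors are at least 1. For `lam ≥ 1` the ratio of h² increases with the
  -- degree, so u ≤ v and it suffices that u q ≥ 1.
  have hmain : 1 ≤ u * v * q ^ 2 := by
    rcases le_total lam 1 with h1 | h1
    · have hu1 := hfac j hj h1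
      have hv1 := hfac l hl h1
      exact one_le_mul_of_one_le_of_one_le (one_le_mul_of_one_le_of_one_le hu1 hv1)
        (one_le_pow₀ hq1)
    · have huv : u ≤ v := by
        refine mul_le_mul ?_ ?_ (by positivity) (by positivity)
        · rw [div_le_div_iff₀ f1 f3]
          nlinarith
        · rw [div_le_div_iff₀ f2 f4]
          nlinarith
      have huq : 1 ≤ u * q := by
        rw [hu, hqdef]
        rw [div_mul_div_comm, div_mul_div_comm, le_div_iff₀ (by positivity), one_mul]
        have hj0 : (0 : ℝ) < j := by linarith
        have i1 : ((j : ℝ) + lam) * (j + 2 * lam) ≤ (j + 1 + lam) * (j + 1 + 2 * lam) :=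
          mul_le_mul (by linarith) (by linarith) f2.le (by linarith)
        have i2 : 0 ≤ ((j : ℝ) + 1 + lam) * (j + 1 + 2 * lam) := by positivity
        nlinarith
      calc (1 : ℝ) ≤ (u * q) ^ 2 := one_le_pow₀ huq
        _ = u * u * q ^ 2 := by ring
        _ ≤ u * v * q ^ 2 := by gcongr
  refine le_of_sq_le_sq ?_ (by positivity)
  rw [hq]
  have : (1 / h lam j * (1 / h lam l) * partialSum lam j) ^ 2 * (u * v * q ^ 2)
      = (1 / h lam (j + 1) * (1 / h lam (l + 1)) * (q * partialSum lam j)) ^ 2 := by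
    simp only [mul_pow, div_pow, one_pow]
    rw [rj, rl]
    have : 0 < v := by
      have : 0 < (l : ℝ) + 1 + lam := by linarith
      positivity
    field_simp
  rw [← this]
  exact le_mul_of_one_le_right (by positivity) hmain

theorem sq_one_div_mul_le (hlam : -1 / 2 < lam) {x : ℝ} (i : ℕ) (hx : x ^ 2 = invNormSq lam i) :
    (1 / (1 / h lam (i + 1) * x)) ^ 2 ≤ 4 + 4 / (1 + 2 * lam) := by
  have h0 : 0 < 4 / (1 + 2 * lam) := div_pos (by norm_num) (by linarith)
  obtain ⟨p, e⟩ := h_sq hlam (show 1 ≤ i + 1 by omega)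
  have : (1 / (1 / h lam (i + 1) * x)) ^ 2 = h lam (i + 1) ^ 2 / invNormSq lam i := by
    rw [← hx]
    field_simp
  rw [this, e, div_div]
  push_cast
  rcases Nat.eq_zero_or_pos i with rfl | hi
  · rw [invNormSq_zero, div_le_iff₀]
    · have := gammaRatio_pos hlam (le_refl 1)
      norm_num
      nlinarith [mul_pos h0 (mul_pos (show 0 < 1 + lam by linarith) this),
        mul_pos (show 0 < 1 / 2 + lam by linarith) this]
    · have := gammaRatio_pos hlam (le_refl 1)
      norm_num
      exact mul_pos (by linarith) (half_pos this)
  · have hi' : (1 : ℝ) ≤ i := by exact_mod_cast hi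
    have hp := invNormSq_pos hlam i
    have hg := gammaRatio_pos hlam hi
    have hr := gammaRatio_succ hlam hi
    rw [div_le_iff₀ (mul_pos (by linarith) hp), invNormSq_of_pos hi]
    have k1 : gammaRatio lam (i + 1) ≤ (i + lam) * gammaRatio lam i := by
      refine le_of_mul_le_mul_left ?_ (show (0 : ℝ) < i + 1 by linarith)
      rw [hr, ← mul_assoc]
      refine mul_le_mul_of_nonneg_right ?_ hg.le
      nlinarith [mul_nonneg (show (0 : ℝ) ≤ i - 1 by linarith) (show (0 : ℝ) ≤ i + lam by linarith)]
    have k2 : 0 < (i + lam) * gammaRatio lam i := mul_pos (by linarith) hg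
    refine k1.trans ?_
    rw [← mul_assoc]
    exact le_mul_of_one_le_left k2.le
      (one_le_mul_of_one_le_of_one_le (by linarith) (by linarith))

/-- The square equals (i + 1) / ((i + 2 lam)(i + lam)(i + 1 + lam)). At i = 1 it blows up as lam →
-1/2, hence the term 4 / (1 + 2 lam) in the bound. -/
theorem sq_one_div_mul_le' (hlam : -1 / 2 < lam) {x : ℝ} {i : ℕ} (hi : 1 ≤ i)
    (hx : x ^ 2 = invNormSq lam (i + 1)) :
    (1 / (1 / h lam i * x)) ^ 2 ≤ 4 + 4 / (1 + 2 * lam) := by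
  have hd : 0 < 1 + 2 * lam := by linarith
  obtain ⟨p, e⟩ := h_sq hlam hi
  have : (1 / (1 / h lam i * x)) ^ 2 = h lam i ^ 2 / invNormSq lam (i + 1) := by
    rw [← hx]
    field_simp
  have hi' : (1 : ℝ) ≤ i := by exact_mod_cast hi
  have hg := gammaRatio_pos hlam hi
  have hg' := gammaRatio_pos hlam (show 1 ≤ i + 1 by omega)
  have hr := gammaRatio_succ hlam hi
  rw [this, e, invNormSq_of_pos (by omega), div_div]
  push_cast
  have f1 : 0 < (i : ℝ) + lam := by linarith
  have f2 : 0 < (i : ℝ) + 1 + lam := by linarith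
  suffices gammaRatio lam i / ((i + lam) * ((i + 1 + lam) * gammaRatio lam (i + 1)))
      ≤ 4 / (1 + 2 * lam) by linarith
  rw [div_le_div_iff₀ (by positivity) hd]
  have k1 : (1 + 2 * lam) * gammaRatio lam i ≤ (i + 1) * gammaRatio lam (i + 1) := by
    rw [hr]
    gcongr
  have k2 : (i : ℝ) + 1 ≤ 4 * ((i + lam) * (i + 1 + lam)) := by nlinarith
  nlinarith

end

/-! ### Gram matrices and comparison of norms -/

theorem matC_gram_apply (a b : ℕ → ℝ) (m : ℕ) (i j : Fin m) (hij : i ≤ j) :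
    ((matC a b m)ᵀ * matC a b m) i j
      = b (i + 1) * b (j + 1) * ∑ k ∈ Finset.range (i + 1), a (k + 1) ^ 2 := by
  rw [Matrix.mul_apply]
  have : ∀ k : Fin m, (matC a b m)ᵀ i k * matC a b m k j
      = (fun k : ℕ => if k ∈ Finset.range (i + 1) then b (i + 1) * b (j + 1) * a (k + 1) ^ 2 else 0)
        k := by
    intro k
    simp only [Matrix.transpose_apply, matC, Matrix.of_apply, Finset.mem_range, Nat.lt_succ_iff]
    by_cases h : k ≤ i
    · have h' : (k : ℕ) ≤ i := h
      rw [if_pos h, if_pos (h.trans hij), if_pos h']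
      ring
    · have h' : ¬ (k : ℕ) ≤ i := h
      rw [if_neg h, if_neg h', zero_mul]
  rw [Finset.sum_congr rfl fun k _ => this k, Fin.sum_univ_eq_sum_range
    (fun k : ℕ => if k ∈ Finset.range (i + 1) then b (i + 1) * b (j + 1) * a (k + 1) ^ 2 else 0),
    Finset.mul_sum, Finset.sum_ite_mem, Finset.inter_eq_right.2]
  exact Finset.range_subset_range.2 i.2

theorem matC_gram_comm (a b : ℕ → ℝ) (m : ℕ) (i j : Fin m) :
    ((matC a b m)ᵀ * matC a b m) i j = ((matC a b m)ᵀ * matC a b m) j i := by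
  have : ((matC a b m)ᵀ * matC a b m)ᵀ = (matC a b m)ᵀ * matC a b m := by
    rw [Matrix.transpose_mul, Matrix.transpose_transpose]
  conv_lhs => rw [← this]
  rfl

theorem dotProduct_mulVec_self {m n : Type*} [Fintype m] [Fintype n] (A : Matrix m n ℝ)
    (t : n → ℝ) : A *ᵥ t ⬝ᵥ A *ᵥ t = ∑ i, ∑ j, t i * t j * (Aᵀ * A) i j := by
  have : A *ᵥ t ⬝ᵥ A *ᵥ t = t ⬝ᵥ (Aᵀ * A) *ᵥ t := by
    rw [← Matrix.mulVec_mulVec, Matrix.dotProduct_mulVec t, Matrix.vecMul_transpose]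
  rw [this]
  simp only [dotProduct, Matrix.mulVec, Finset.mul_sum]
  exact Finset.sum_congr rfl fun i _ => Finset.sum_congr rfl fun j _ => by ring

/-- A bound for the quadratic form of a Gram matrix passes to every matrix whose Gram matrix is
dominated entrywise by a principal submatrix. -/
theorem norm_le_of_gram_le {ι κ m n : Type*} [Fintype ι] [Fintype κ] [Fintype m] [Fintype n]
    {A : Matrix m ι ℝ} {B : Matrix n κ ℝ} (e : ι → κ) (he : Function.Injective e)
    (hAB : ∀ i j, |(Aᵀ * A) i j| ≤ (Bᵀ * B) (e i) (e j)) {μ : ℝ} (hμ : 0 ≤ μ)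
    (hB : ∀ t, μ * (B *ᵥ t ⬝ᵥ B *ᵥ t) ≤ t ⬝ᵥ t) (t : ι → ℝ) :
    μ * (A *ᵥ t ⬝ᵥ A *ᵥ t) ≤ t ⬝ᵥ t := by
  classical
  -- Since the dominating Gram entries are nonnegative on the range of e, passing to |t| and
  -- transporting it along e can only increase the form, while the length is preserved.
  set u : κ → ℝ := Function.extend e (fun i => |t i|) 0 with hu
  have hue : ∀ i, u (e i) = |t i| := fun i => he.extend_apply _ _ i
  have hu0 : ∀ k, k ∉ Set.range e → u k = 0 := fun k hk => by
    rw [hu, Function.extend_apply' _ _ _ (by simpa using hk)]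
    rfl
  have h1 : t ⬝ᵥ t = u ⬝ᵥ u :=
    Fintype.sum_of_injective e he _ _ (fun k hk => by simp [hu0 k hk])
      (fun i => by rw [hue, abs_mul_abs_self])
  have h2 : A *ᵥ t ⬝ᵥ A *ᵥ t ≤ B *ᵥ u ⬝ᵥ B *ᵥ u := by
    rw [dotProduct_mulVec_self, dotProduct_mulVec_self]
    have h3 : ∑ i, ∑ j, u i * u j * (Bᵀ * B) i j
        = ∑ i, ∑ j, |t i| * |t j| * (Bᵀ * B) (e i) (e j) := by
      symm
      refine Fintype.sum_of_injective e he _ _ (fun k hk => ?_) (fun i => ?_)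
      · simp [hu0 k hk]
      · refine Fintype.sum_of_injective e he _ _ (fun k hk => ?_) (fun j => ?_)
        · simp [hu0 k hk]
        · rw [hue, hue]
    rw [h3]
    refine Finset.sum_le_sum fun i _ => Finset.sum_le_sum fun j _ => ?_
    calc t i * t j * (Aᵀ * A) i j ≤ |t i * t j * (Aᵀ * A) i j| := le_abs_self _
      _ = |t i| * |t j| * |(Aᵀ * A) i j| := by rw [abs_mul, abs_mul]
      _ ≤ _ := mul_le_mul_of_nonneg_left (hAB i j) (by positivity)
  rw [h1]
  exact (mul_le_mul_of_nonneg_left h2 hμ).trans (hB u)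

/-! ### Reduction of the Markov quotient to the two parity blocks -/

/-- The constant in the norms of the Gegenbauer polynomials. -/
noncomputable def normConst {lam : ℝ} (hlam : -1 / 2 < lam) : ℝ := invNormSq lam 0 * wint hlam (gegen lam 0 * gegen lam 0)

theorem normConst_pos {lam : ℝ} (hlam : -1 / 2 < lam) : 0 < normConst hlam := by
  refine mul_pos (invNormSq_pos hlam 0) ?_
  simpa [gegen] using wint_one_pos hlam

theorem wint_gegen_sq {lam : ℝ} (hlam : -1 / 2 < lam) (n : ℕ) :
    wint hlam (gegen lam n * gegen lam n) = normConst hlam / invNormSq lam n := by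
  rw [eq_div_iff (invNormSq_pos hlam n).ne', normConst, ← invNormSq_mul_wint_gegen_sq hlam n,
    mul_comm]

theorem wint_sum_mul_sum {lam : ℝ} (hlam : -1 / 2 < lam) {ι κ : Type*} [Fintype ι] [Fintype κ] (x : ι → ℝ) (y : κ → ℝ)
    (f : ι → ℝ[X]) (g : κ → ℝ[X]) :
    wint hlam ((∑ i, C (x i) * f i) * ∑ j, C (y j) * g j)
      = ∑ i, ∑ j, x i * y j * wint hlam (f i * g j) := by
  rw [Finset.sum_mul_sum, map_sum]
  refine Finset.sum_congr rfl fun i _ => ?_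
  rw [map_sum]
  refine Finset.sum_congr rfl fun j _ => ?_
  rw [← wint_C_mul, C_mul]
  congr 1
  ring

theorem wint_sum_sq {lam : ℝ} (hlam : -1 / 2 < lam) {ι : Type*} [Fintype ι] [DecidableEq ι] (x : ι → ℝ) (e : ι → ℕ)
    (he : Function.Injective e) :
    wint hlam ((∑ i, C (x i) * gegen lam (e i)) * ∑ i, C (x i) * gegen lam (e i))
      = normConst hlam * ∑ i, x i ^ 2 / invNormSq lam (e i) := by
  rw [wint_sum_mul_sum, Finset.mul_sum]
  refine Finset.sum_congr rfl fun i _ => ?_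
  rw [Finset.sum_eq_single i]
  · rw [wint_gegen_sq]
    ring
  · intro j _ hj
    rw [wint_gegen_mul_gegen hlam (he.ne hj.symm), mul_zero]
  · simp

theorem wint_sum_mul_sum_eq_zero {lam : ℝ} (hlam : -1 / 2 < lam) {ι κ : Type*} [Fintype ι] [Fintype κ] (x : ι → ℝ) (y : κ → ℝ)
    (e : ι → ℕ) (g : κ → ℕ) (h : ∀ i j, e i ≠ g j) :
    wint hlam ((∑ i, C (x i) * gegen lam (e i)) * ∑ j, C (y j) * gegen lam (g j)) = 0 := by
  rw [wint_sum_mul_sum]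
  exact Finset.sum_eq_zero fun i _ => Finset.sum_eq_zero fun j _ => by
    rw [wint_gegen_mul_gegen hlam (h i j), mul_zero]

/-- The polynomial with coordinates `t` in the orthogonal system of Gegenbauer polynomials of
positive degree and of one parity: odd for `r = 0`, even for `r = 1`. -/
noncomputable def parityPoly (lam : ℝ) (r : ℕ) {m : ℕ} (t : Fin m → ℝ) : ℝ[X] :=
  ∑ l : Fin m, C (t l * (gammaRatio lam (2 * l + 1 + r) * (1 / h lam (2 * l + 1 + r))))
    * gegen lam (2 * l + 1 + r)

theorem wint_parityPoly_sq {lam : ℝ} (hlam : -1 / 2 < lam) (r : ℕ) {m : ℕ} (t : Fin m → ℝ) :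
    wint hlam (parityPoly lam r t * parityPoly lam r t) = normConst hlam * (t ⬝ᵥ t) := by
  rw [parityPoly, wint_sum_sq hlam _ (fun l : Fin m => 2 * (l : ℕ) + 1 + r)
    (fun i j hij => Fin.ext (by simpa using hij)), dotProduct]
  congr 1
  refine Finset.sum_congr rfl fun l _ => ?_
  rw [mul_pow, sq_gammaRatio_div_h hlam (by omega),
    mul_div_cancel_right₀ _ (invNormSq_pos hlam _).ne', sq]

/-- The factor γ_n in the coordinates is absorbed by the derivative expansion. Writing d_k as a · a
then leaves one a in C and one outside, the latter cancelling against ‖G_k‖² in the norm. -/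
theorem derivative_parityPoly {lam : ℝ} (hlam : -1 / 2 < lam) {r : ℕ} (hr : r ≤ 1) {a b : ℕ → ℝ}
    (ha : ∀ k, a (k + 1) ^ 2 = invNormSq lam (2 * k + r))
    (hb : ∀ k, b (k + 1) = 1 / h lam (2 * k + 1 + r)) {m : ℕ} (t : Fin m → ℝ) :
    derivative (parityPoly lam r t)
      = ∑ k : Fin m, C (2 * a (k + 1) * (matC a b m *ᵥ t) k) * gegen lam (2 * k + r) := by
  have hl : ∀ l : Fin m, derivative (C (t l * (gammaRatio lam (2 * l + 1 + r)
        * (1 / h lam (2 * l + 1 + r)))) * gegen lam (2 * l + 1 + r))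
      = ∑ k : Fin m, C (2 * a (k + 1) * (matC a b m k l * t l)) * gegen lam (2 * k + r) := by
    intro l
    rw [derivative_C_mul]
    have e : C (t l * (gammaRatio lam (2 * l + 1 + r) * (1 / h lam (2 * l + 1 + r))))
        * derivative (gegen lam (2 * l + 1 + r))
        = C (t l * (1 / h lam (2 * l + 1 + r))) * (C (gammaRatio lam (2 * l + 1 + r))
          * derivative (gegen lam (2 * l + 1 + r))) := by
      rw [← mul_assoc (C _) (C _), ← C_mul]
      congr 2
      ring
    rw [e, gammaRatio_mul_derivative_gegen hlam r hr, Finset.mul_sum]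
    have e2 : ∀ k : Fin m, C (2 * a (k + 1) * (matC a b m k l * t l)) * gegen lam (2 * k + r)
        = (fun k : ℕ => if k ∈ Finset.range (l + 1) then
          C (t l * (1 / h lam (2 * l + 1 + r))) * (C (2 * invNormSq lam (2 * k + r))
            * gegen lam (2 * k + r)) else 0) k := by
      intro k
      simp only [matC, Matrix.of_apply, Finset.mem_range, Nat.lt_succ_iff]
      by_cases hk : k ≤ l
      · rw [if_pos hk, if_pos (show (k : ℕ) ≤ l from hk), ← mul_assoc (C _) (C _), ← C_mul, ← ha, hb]
        congr 2
        ring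
      · rw [if_neg hk, if_neg (show ¬ (k : ℕ) ≤ l from hk)]
        simp
    rw [Finset.sum_congr rfl fun k _ => e2 k, Fin.sum_univ_eq_sum_range
      (fun k : ℕ => if k ∈ Finset.range (l + 1) then
          C (t l * (1 / h lam (2 * l + 1 + r))) * (C (2 * invNormSq lam (2 * k + r))
            * gegen lam (2 * k + r)) else 0), Finset.sum_ite_mem, Finset.inter_eq_right.2]
    exact Finset.range_subset_range.2 l.2
  rw [parityPoly, derivative_sum, Finset.sum_congr rfl fun l _ => hl l, Finset.sum_comm]
  refine Finset.sum_congr rfl fun k _ => ?_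
  rw [← Finset.sum_mul, ← map_sum, ← Finset.mul_sum]
  rfl

theorem wint_derivative_parityPoly_sq {lam : ℝ} (hlam : -1 / 2 < lam) {r : ℕ} (hr : r ≤ 1) {a b : ℕ → ℝ}
    (ha : ∀ k, a (k + 1) ^ 2 = invNormSq lam (2 * k + r))
    (hb : ∀ k, b (k + 1) = 1 / h lam (2 * k + 1 + r)) {m : ℕ} (t : Fin m → ℝ) :
    wint hlam (derivative (parityPoly lam r t) * derivative (parityPoly lam r t))
      = 4 * normConst hlam * (matC a b m *ᵥ t ⬝ᵥ matC a b m *ᵥ t) := by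
  rw [derivative_parityPoly hlam hr ha hb, wint_sum_sq hlam _ (fun l : Fin m => 2 * (l : ℕ) + r)
    (fun i j hij => Fin.ext (by simpa using hij)), dotProduct, Finset.mul_sum, Finset.mul_sum]
  refine Finset.sum_congr rfl fun l _ => ?_
  have := (invNormSq_pos hlam (2 * l + r)).ne'
  rw [mul_pow, mul_pow, ha]
  field_simp
  ring

theorem natDegree_parityPoly_le {lam : ℝ} {r m n : ℕ} (hn : 2 * m + r ≤ n + 1) (t : Fin m → ℝ) :
    (parityPoly lam r t).natDegree ≤ n := by
  refine natDegree_sum_le_of_forall_le _ _ fun l _ => ?_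
  have := l.2
  exact (natDegree_C_mul_le _ _).trans ((natDegree_gegen_le _).trans (by omega))

theorem sum_range_eq_parity_sums (g : ℕ → ℝ[X]) (m₀ m₁ : ℕ) (hm : m₀ = m₁ ∨ m₀ = m₁ + 1) :
    ∑ j ∈ Finset.range (m₀ + m₁ + 1), g j
      = g 0 + ∑ l ∈ Finset.range m₀, g (2 * l + 1) + ∑ l ∈ Finset.range m₁, g (2 * l + 2) := by
  have key : ∀ m, ∑ j ∈ Finset.range (2 * m + 1), g j
      = g 0 + ∑ l ∈ Finset.range m, g (2 * l + 1) + ∑ l ∈ Finset.range m, g (2 * l + 2) := by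
    intro m
    induction m with
    | zero => simp
    | succ m ih =>
      rw [show 2 * (m + 1) + 1 = 2 * m + 1 + 1 + 1 by ring, Finset.sum_range_succ,
        Finset.sum_range_succ, ih, Finset.sum_range_succ (fun l => g (2 * l + 1)),
        Finset.sum_range_succ (fun l => g (2 * l + 2))]
      ring
  rcases hm with rfl | rfl
  · rw [← key]
    congr 2
    ring
  · rw [show m₁ + 1 + m₁ + 1 = 2 * m₁ + 1 + 1 by ring, Finset.sum_range_succ, key,
      Finset.sum_range_succ (fun l => g (2 * l + 1)) m₁]
    ring

theorem exists_eq_parityPoly_add {lam : ℝ} (hlam : -1 / 2 < lam) {m₀ m₁ : ℕ} (hm : m₀ = m₁ ∨ m₀ = m₁ + 1) {p : ℝ[X]}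
    (hp : p.natDegree ≤ m₀ + m₁) : ∃ (c : ℝ) (t₀ : Fin m₀ → ℝ) (t₁ : Fin m₁ → ℝ),
      p = C c * gegen lam 0 + parityPoly lam 0 t₀ + parityPoly lam 1 t₁ := by
  obtain ⟨x, rfl⟩ := exists_eq_sum_gegen hlam _ p hp
  have hne : ∀ j, 1 ≤ j → gammaRatio lam j * (1 / h lam j) ≠ 0 := fun j hj =>
    mul_ne_zero (gammaRatio_pos hlam hj).ne' (one_div_ne_zero (h_sq hlam hj).1.ne')
  refine ⟨x 0, fun l => x (2 * l + 1) / (gammaRatio lam (2 * l + 1) * (1 / h lam (2 * l + 1))),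
    fun l => x (2 * l + 2) / (gammaRatio lam (2 * l + 2) * (1 / h lam (2 * l + 2))), ?_⟩
  rw [sum_range_eq_parity_sums _ m₀ m₁ hm, parityPoly, parityPoly,
    ← Fin.sum_univ_eq_sum_range (fun l => C (x (2 * l + 1)) * gegen lam (2 * l + 1)),
    ← Fin.sum_univ_eq_sum_range (fun l => C (x (2 * l + 2)) * gegen lam (2 * l + 2))]
  congr 1
  · congr 1
    refine Finset.sum_congr rfl fun l _ => ?_
    rw [add_zero, div_mul_cancel₀ _ (hne _ (by omega))]
  · refine Finset.sum_congr rfl fun l _ => ?_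
    rw [div_mul_cancel₀ _ (hne _ (by omega))]

theorem alphaTilde_succ_sq' {lam : ℝ} (hlam : -1 / 2 < lam) (k : ℕ) : alphaTilde lam (k + 1) ^ 2 = invNormSq lam (2 * k + 0) :=
  alphaTilde_succ_sq hlam k

theorem betaTilde_succ (lam : ℝ) (k : ℕ) : betaTilde lam (k + 1) = 1 / h lam (2 * k + 1 + 0) := rfl

theorem beta_succ (lam : ℝ) (k : ℕ) : beta lam (k + 1) = 1 / h lam (2 * k + 1 + 1) := rfl

/-- All cross terms vanish by orthogonality. The constant term only enlarges ‖p‖ and does not affect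
p', so it is dropped. -/
theorem wint_decomposition_sq {lam : ℝ} (hlam : -1 / 2 < lam) {m₀ m₁ : ℕ} (c : ℝ) (t₀ : Fin m₀ → ℝ) (t₁ : Fin m₁ → ℝ) :
    normConst hlam * (t₀ ⬝ᵥ t₀ + t₁ ⬝ᵥ t₁)
      ≤ wint hlam ((C c * gegen lam 0 + parityPoly lam 0 t₀ + parityPoly lam 1 t₁)
        * (C c * gegen lam 0 + parityPoly lam 0 t₀ + parityPoly lam 1 t₁)) := by
  have hc : C c * gegen lam 0 = ∑ i : Fin 1, C ((fun _ => c) i) * gegen lam ((fun _ => 0) i) := by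
    simp
  have h0 : wint hlam (C c * gegen lam 0 * (C c * gegen lam 0)) ≥ 0 := by
    rw [mul_assoc, wint_C_mul, mul_left_comm, wint_C_mul, ← mul_assoc]
    refine mul_nonneg (mul_self_nonneg c) ?_
    simpa [gegen] using (wint_one_pos hlam).le
  have h1 := wint_parityPoly_sq hlam 0 t₀
  have h2 := wint_parityPoly_sq hlam 1 t₁
  have h3 : wint hlam (C c * gegen lam 0 * parityPoly lam 0 t₀) = 0 := by
    rw [hc, parityPoly]
    exact wint_sum_mul_sum_eq_zero hlam _ _ _ _ fun i j => by simp
  have h4 : wint hlam (C c * gegen lam 0 * parityPoly lam 1 t₁) = 0 := by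
    rw [hc, parityPoly]
    exact wint_sum_mul_sum_eq_zero hlam _ _ _ _ fun i j => by simp
  have h5 : wint hlam (parityPoly lam 0 t₀ * parityPoly lam 1 t₁) = 0 := by
    rw [parityPoly, parityPoly]
    exact wint_sum_mul_sum_eq_zero hlam _ _ _ _ fun i j => by omega
  have e : ∀ x y z : ℝ[X], (x + y + z) * (x + y + z)
      = x * x + y * y + z * z + (x * y + x * y) + (x * z + x * z) + (y * z + y * z) := by
    intro x y z
    ring
  rw [e]
  simp only [map_add, h1, h2, h3, h4, h5]
  linarith

theorem wint_decomposition_derivative_sq {lam : ℝ} (hlam : -1 / 2 < lam) {m₀ m₁ : ℕ} (c : ℝ) (t₀ : Fin m₀ → ℝ) (t₁ : Fin m₁ → ℝ) :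
    wint hlam (derivative (C c * gegen lam 0 + parityPoly lam 0 t₀ + parityPoly lam 1 t₁)
        * derivative (C c * gegen lam 0 + parityPoly lam 0 t₀ + parityPoly lam 1 t₁))
      = 4 * normConst hlam *
        (matC (alphaTilde lam) (betaTilde lam) m₀ *ᵥ t₀ ⬝ᵥ
            matC (alphaTilde lam) (betaTilde lam) m₀ *ᵥ t₀
          + matC (alpha lam) (beta lam) m₁ *ᵥ t₁ ⬝ᵥ matC (alpha lam) (beta lam) m₁ *ᵥ t₁) := by
  have h1 := wint_derivative_parityPoly_sq hlam (show 0 ≤ 1 by omega) (alphaTilde_succ_sq' hlam)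
    (betaTilde_succ lam) t₀
  have h2 := wint_derivative_parityPoly_sq hlam le_rfl (alpha_succ_sq hlam) (beta_succ lam) t₁
  have h3 : wint hlam (derivative (parityPoly lam 0 t₀) * derivative (parityPoly lam 1 t₁)) = 0 := by
    rw [derivative_parityPoly hlam (show 0 ≤ 1 by omega) (alphaTilde_succ_sq' hlam) (betaTilde_succ lam),
      derivative_parityPoly hlam le_rfl (alpha_succ_sq hlam) (beta_succ lam)]
    exact wint_sum_mul_sum_eq_zero hlam _ _ _ _ fun i j => by omega
  have h0 : derivative (C c * gegen lam 0) = 0 := by simp [gegen]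
  have e : ∀ y z : ℝ[X], (0 + y + z) * (0 + y + z) = y * y + z * z + (y * z + y * z) := by
    intro y z
    ring
  rw [derivative_add, derivative_add, h0, e]
  simp only [map_add, h1, h2, h3]
  ring

theorem wnorm_ratio_eq {lam : ℝ} (hlam : -1 / 2 < lam) (p : ℝ[X]) : wnorm lam (derivative p) / wnorm lam p
    = Real.sqrt (wint hlam (derivative p * derivative p) / wint hlam (p * p)) := by
  rw [wnorm_eq hlam, wnorm_eq hlam, Real.sqrt_div']
  rw [wint]
  refine intervalIntegral.integral_nonneg (by norm_num) fun t ht => mul_nonneg ?_ ?_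
  · exact Real.rpow_nonneg (by nlinarith [ht.1, ht.2]) _
  · rw [eval_mul]
    exact mul_self_nonneg _

theorem isGreatest_markovRatios {lam : ℝ} (hlam : -1 / 2 < lam) {n : ℕ} {μ : ℝ} (hμ : 0 < μ)
    (hle : ∀ p : ℝ[X], p.natDegree ≤ n →
      μ * wint hlam (derivative p * derivative p) ≤ 4 * wint hlam (p * p))
    (hex : ∃ p : ℝ[X], p.natDegree ≤ n ∧ 0 < wint hlam (p * p) ∧
      μ * wint hlam (derivative p * derivative p) = 4 * wint hlam (p * p)) :
    IsGreatest (markovRatios n lam) (2 / Real.sqrt μ) := by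
  have hval : 2 / Real.sqrt μ = Real.sqrt (4 / μ) := by
    rw [Real.sqrt_div (by norm_num), show (4 : ℝ) = 2 ^ 2 by norm_num, Real.sqrt_sq (by norm_num)]
  rw [hval]
  refine ⟨?_, ?_⟩
  · obtain ⟨p, hp, hpos, heq⟩ := hex
    refine ⟨p, hp, ?_, ?_⟩
    · rintro rfl
      simp at hpos
    · rw [wnorm_ratio_eq hlam]
      congr 1
      rw [div_eq_div_iff hμ.ne' hpos.ne']
      linarith
  · rintro _ ⟨p, hp, -, rfl⟩
    rw [wnorm_ratio_eq hlam]
    refine Real.sqrt_le_sqrt ?_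
    -- Definiteness of the norm is not needed: with a nonpositive denominator the quotient is at
    -- most 0, division by 0 giving 0.
    rcases le_or_gt (wint hlam (p * p)) 0 with h0 | h0
    · have : 0 ≤ wint hlam (derivative p * derivative p) := by
        refine intervalIntegral.integral_nonneg (by norm_num) fun t ht => mul_nonneg ?_ ?_
        · exact Real.rpow_nonneg (by nlinarith [ht.1, ht.2]) _
        · rw [eval_mul]
          exact mul_self_nonneg _
      exact (div_nonpos_of_nonneg_of_nonpos this h0).trans (by positivity)
    · rw [div_le_div_iff₀ h0 hμ]
      linarith [hle p hp]

theorem isGreatest_markovRatios_of_parity {lam : ℝ} (hlam : -1 / 2 < lam) {m₀ m₁ n : ℕ} (hm : m₀ = m₁ ∨ m₀ = m₁ + 1)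
    (hn : n = m₀ + m₁) {μ : ℝ} (hμ : 0 < μ)
    (h₀ : ∀ t, μ * (matC (alphaTilde lam) (betaTilde lam) m₀ *ᵥ t ⬝ᵥ
      matC (alphaTilde lam) (betaTilde lam) m₀ *ᵥ t) ≤ t ⬝ᵥ t)
    (h₁ : ∀ t, μ * (matC (alpha lam) (beta lam) m₁ *ᵥ t ⬝ᵥ
      matC (alpha lam) (beta lam) m₁ *ᵥ t) ≤ t ⬝ᵥ t)
    (hex : (∃ t ≠ 0, μ * (matC (alphaTilde lam) (betaTilde lam) m₀ *ᵥ t ⬝ᵥ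
        matC (alphaTilde lam) (betaTilde lam) m₀ *ᵥ t) = t ⬝ᵥ t ∧ m₀ = m₁ + 1) ∨
      ∃ t ≠ 0, μ * (matC (alpha lam) (beta lam) m₁ *ᵥ t ⬝ᵥ
        matC (alpha lam) (beta lam) m₁ *ᵥ t) = t ⬝ᵥ t ∧ m₀ = m₁) :
    IsGreatest (markovRatios n lam) (2 / Real.sqrt μ) := by
  have hκ := normConst_pos hlam
  have hpos : ∀ {m : ℕ} {t : Fin m → ℝ}, t ≠ 0 → 0 < t ⬝ᵥ t := fun ht =>
    lt_of_le_of_ne (Finset.sum_nonneg fun i _ => mul_self_nonneg _)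
      (Ne.symm (dotProduct_self_eq_zero.not.2 ht))
  refine isGreatest_markovRatios hlam hμ (fun p hp => ?_) ?_
  · rw [hn] at hp
    obtain ⟨c, t₀, t₁, rfl⟩ := exists_eq_parityPoly_add hlam hm hp
    rw [wint_decomposition_derivative_sq hlam]
    have := wint_decomposition_sq hlam c t₀ t₁
    nlinarith [h₀ t₀, h₁ t₁]
  · rcases hex with ⟨t, ht, heq, hm'⟩ | ⟨t, ht, heq, hm'⟩
    · refine ⟨parityPoly lam 0 t, natDegree_parityPoly_le (by omega) t, ?_, ?_⟩
      · rw [wint_parityPoly_sq]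
        exact mul_pos hκ (hpos ht)
      · rw [wint_parityPoly_sq, wint_derivative_parityPoly_sq hlam (show 0 ≤ 1 by omega)
          (alphaTilde_succ_sq' hlam) (betaTilde_succ lam), ← heq]
        ring
    · refine ⟨parityPoly lam 1 t, natDegree_parityPoly_le (by omega) t, ?_, ?_⟩
      · rw [wint_parityPoly_sq]
        exact mul_pos hκ (hpos ht)
      · rw [wint_parityPoly_sq, wint_derivative_parityPoly_sq hlam le_rfl
          (alpha_succ_sq hlam) (beta_succ lam), ← heq]
        ring

/-! ### Comparison of the two parities and the best constants -/

theorem matC_gram_parity {lam : ℝ} (hlam : -1 / 2 < lam) {r : ℕ} (hr : r ≤ 1) {a b : ℕ → ℝ}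
    (ha : ∀ k, a (k + 1) ^ 2 = invNormSq lam (2 * k + r))
    (hb : ∀ k, b (k + 1) = 1 / h lam (2 * k + 1 + r)) {m : ℕ} (i j : Fin m) (hij : i ≤ j) :
    ((matC a b m)ᵀ * matC a b m) i j
      = 1 / h lam (2 * i + 1 + r) * (1 / h lam (2 * j + 1 + r)) * partialSum lam (2 * i + 1 + r) := by
  rw [matC_gram_apply a b m i j hij, ← sum_invNormSq hlam r hr, hb, hb]
  congr 1
  exact Finset.sum_congr rfl fun k _ => ha k

/-- Index i stands for degree 2i + 1 + r. The condition on s says that e raises this degree by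
exactly one, which changes the parity: s = 0 from odd to even degrees, s = 1 from even to odd. -/
theorem matC_gram_mono {lam : ℝ} (hlam : -1 / 2 < lam) {r r' s : ℕ} (hr : r ≤ 1) (hr' : r' ≤ 1) {a b a' b' : ℕ → ℝ}
    (ha : ∀ k, a (k + 1) ^ 2 = invNormSq lam (2 * k + r))
    (hb : ∀ k, b (k + 1) = 1 / h lam (2 * k + 1 + r))
    (ha' : ∀ k, a' (k + 1) ^ 2 = invNormSq lam (2 * k + r'))
    (hb' : ∀ k, b' (k + 1) = 1 / h lam (2 * k + 1 + r')) {m m' : ℕ} (e : Fin m → Fin m')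
    (he : ∀ i, (e i : ℕ) = i + s) (hs : 2 * s + r' = r + 1) (i j : Fin m) :
    |((matC a b m)ᵀ * matC a b m) i j| ≤ ((matC a' b' m')ᵀ * matC a' b' m') (e i) (e j) := by
  wlog hij : i ≤ j generalizing i j
  · rw [matC_gram_comm, matC_gram_comm a' b']
    exact this j i (le_of_not_ge hij)
  have heij : e i ≤ e j := by
    rw [Fin.le_def, he, he]
    exact Nat.add_le_add_right hij s
  rw [matC_gram_parity hlam hr ha hb i j hij, matC_gram_parity hlam hr' ha' hb' _ _ heij, he, he]
  have e1 : ∀ i : ℕ, 2 * (i + s) + 1 + r' = 2 * i + 1 + r + 1 := fun i => by omega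
  rw [e1, e1, abs_of_nonneg]
  · exact gram_entry_mono hlam (by omega) (by have : (i : ℕ) ≤ j := hij; omega)
  · have h1 := (h_sq hlam (show 1 ≤ 2 * (i : ℕ) + 1 + r by omega)).1
    have h2 := (h_sq hlam (show 1 ≤ 2 * (j : ℕ) + 1 + r by omega)).1
    have h3 := partialSum_pos hlam (show 1 ≤ 2 * (i : ℕ) + 1 + r by omega)
    positivity

theorem alpha_ne_zero {lam : ℝ} (hlam : -1 / 2 < lam) (k : ℕ) (hk : 1 ≤ k) : alpha lam k ≠ 0 := by
  obtain ⟨k, rfl⟩ : ∃ j, k = j + 1 := ⟨k - 1, by omega⟩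
  rw [← sq_pos_iff, alpha_succ_sq hlam]
  exact invNormSq_pos hlam _

theorem alphaTilde_ne_zero {lam : ℝ} (hlam : -1 / 2 < lam) (k : ℕ) (hk : 1 ≤ k) : alphaTilde lam k ≠ 0 := by
  obtain ⟨k, rfl⟩ : ∃ j, k = j + 1 := ⟨k - 1, by omega⟩
  rw [← sq_pos_iff, alphaTilde_succ_sq hlam]
  exact invNormSq_pos hlam _

theorem beta_ne_zero {lam : ℝ} (hlam : -1 / 2 < lam) (k : ℕ) (hk : 1 ≤ k) : beta lam k ≠ 0 :=
  one_div_ne_zero (h_sq hlam (by omega)).1.ne'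

theorem betaTilde_ne_zero {lam : ℝ} (hlam : -1 / 2 < lam) (k : ℕ) (hk : 1 ≤ k) : betaTilde lam k ≠ 0 :=
  one_div_ne_zero (h_sq hlam (by omega)).1.ne'

theorem orthogonalOnHalfLine_polyP_alpha_beta {lam : ℝ} (hlam : -1 / 2 < lam) :
    OrthogonalOnHalfLine (polyP (alpha lam) (beta lam)) := by
  refine orthogonalOnHalfLine_polyP (K := 4 + 4 / (1 + 2 * lam)) (alpha_ne_zero hlam)
    (beta_ne_zero hlam) (fun k hk => ?_) (fun k hk => ?_)
  · obtain ⟨k, rfl⟩ : ∃ j, k = j + 1 := ⟨k - 1, by omega⟩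
    exact sq_one_div_mul_le hlam (2 * k + 1) (alpha_succ_sq hlam k)
  · exact sq_one_div_mul_le' hlam (show 1 ≤ 2 * k by omega) (alpha_succ_sq hlam k)

theorem orthogonalOnHalfLine_polyP_alphaTilde_betaTilde {lam : ℝ} (hlam : -1 / 2 < lam) :
    OrthogonalOnHalfLine (polyP (alphaTilde lam) (betaTilde lam)) := by
  refine orthogonalOnHalfLine_polyP (K := 4 + 4 / (1 + 2 * lam)) (alphaTilde_ne_zero hlam)
    (betaTilde_ne_zero hlam) (fun k hk => ?_) (fun k hk => ?_)
  · obtain ⟨k, rfl⟩ : ∃ j, k = j + 1 := ⟨k - 1, by omega⟩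
    exact sq_one_div_mul_le hlam (2 * k) (alphaTilde_succ_sq hlam k)
  · obtain ⟨k, rfl⟩ : ∃ j, k = j + 1 := ⟨k - 1, by omega⟩
    exact sq_one_div_mul_le' hlam (show 1 ≤ 2 * k + 1 by omega) (alphaTilde_succ_sq hlam (k + 1))

theorem markovConst_even {lam : ℝ} (hlam : -1 / 2 < lam) {m : ℕ} (hm : 1 ≤ m) :
    IsLUB (markovRatios (2 * m) lam) (markovConst (2 * m) lam) ∧
      ∃ μ₁ : ℝ, IsLeast {x : ℝ | (polyP (alpha lam) (beta lam) m).IsRoot x} μ₁ ∧ 0 < μ₁ ∧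
        markovConst (2 * m) lam = 2 / Real.sqrt μ₁ := by
  obtain ⟨μ, hleast, hμ, hle, t, ht, heq⟩ :=
    exists_least_root (alpha_ne_zero hlam) (beta_ne_zero hlam) hm
  have hg : IsGreatest (markovRatios (2 * m) lam) (2 / Real.sqrt μ) := by
    refine isGreatest_markovRatios_of_parity hlam (m₀ := m) (m₁ := m) (Or.inl rfl) (by omega) hμ
      ?_ hle (Or.inr ⟨t, ht, heq, rfl⟩)
    -- Degrees 1, 3, ..., 2m - 1 go to 2, 4, ..., 2m, so the even block wins.
    exact norm_le_of_gram_le id Function.injective_id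
      (matC_gram_mono hlam (s := 0) (by omega) le_rfl (alphaTilde_succ_sq' hlam) (betaTilde_succ lam)
        (alpha_succ_sq hlam) (beta_succ lam) id (fun _ => rfl) rfl) hμ.le hle
  have hc : markovConst (2 * m) lam = 2 / Real.sqrt μ := hg.csSup_eq
  exact ⟨hc ▸ hg.isLUB, μ, hleast, hμ, hc⟩

theorem markovConst_odd {lam : ℝ} (hlam : -1 / 2 < lam) {m : ℕ} (hm : 1 ≤ m) :
    IsLUB (markovRatios (2 * m - 1) lam) (markovConst (2 * m - 1) lam) ∧
      ∃ μ₁ : ℝ, IsLeast {x : ℝ | (polyP (alphaTilde lam) (betaTilde lam) m).IsRoot x} μ₁ ∧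
        0 < μ₁ ∧ markovConst (2 * m - 1) lam = 2 / Real.sqrt μ₁ := by
  obtain ⟨m, rfl⟩ : ∃ j, m = j + 1 := ⟨m - 1, by omega⟩
  obtain ⟨μ, hleast, hμ, hle, t, ht, heq⟩ :=
    exists_least_root (alphaTilde_ne_zero hlam) (betaTilde_ne_zero hlam) hm
  have hg : IsGreatest (markovRatios (2 * (m + 1) - 1) lam) (2 / Real.sqrt μ) := by
    refine isGreatest_markovRatios_of_parity hlam (m₀ := m + 1) (m₁ := m) (Or.inr rfl) (by omega) hμ
      hle ?_ (Or.inl ⟨t, ht, heq, rfl⟩)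
    -- With m lowered by one, degrees 2, 4, ..., 2m go to 3, 5, ..., 2m + 1. The odd block has the
    -- extra degree 1, hence `Fin.succ`.
    exact norm_le_of_gram_le Fin.succ (Fin.succ_injective m)
      (matC_gram_mono hlam (s := 1) le_rfl (by omega) (alpha_succ_sq hlam) (beta_succ lam)
        (alphaTilde_succ_sq' hlam) (betaTilde_succ lam) Fin.succ (fun _ => rfl) rfl) hμ.le hle
  have hc : markovConst (2 * (m + 1) - 1) lam = 2 / Real.sqrt μ := hg.csSup_eq
  exact ⟨hc ▸ hg.isLUB, μ, hleast, hμ, hc⟩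

end GegenbauerMarkov

open GegenbauerMarkov in
theorem theorem2p3 (lam : ℝ) (hlam : -1 / 2 < lam) :
    -- the best constant for `n = 2m`
    (∀ m : ℕ, 1 ≤ m →
      IsLUB (markovRatios (2 * m) lam) (markovConst (2 * m) lam) ∧
      ∃ μ₁ : ℝ, IsLeast {x : ℝ | (polyP (alpha lam) (beta lam) m).IsRoot x} μ₁ ∧ 0 < μ₁ ∧
        markovConst (2 * m) lam = 2 / Real.sqrt μ₁) ∧
    -- the best constant for `n = 2m - 1`
    (∀ m : ℕ, 1 ≤ m →
      IsLUB (markovRatios (2 * m - 1) lam) (markovConst (2 * m - 1) lam) ∧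
      ∃ μ₁ : ℝ, IsLeast {x : ℝ | (polyP (alphaTilde lam) (betaTilde lam) m).IsRoot x} μ₁ ∧ 0 < μ₁ ∧
        markovConst (2 * m - 1) lam = 2 / Real.sqrt μ₁) ∧
    -- the matrices `A_m` are invertible, and the `B_m` are positive definite and tridiagonal
    (∀ m : ℕ,
      IsUnit (matA (alpha lam) (beta lam) m).det ∧
      (matB (alpha lam) (beta lam) m).PosDef ∧
      matB (alpha lam) (beta lam) m = tridiag (alpha lam) (beta lam) m) ∧
    (∀ m : ℕ,
      IsUnit (matA (alphaTilde lam) (betaTilde lam) m).det ∧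
      (matB (alphaTilde lam) (betaTilde lam) m).PosDef ∧
      matB (alphaTilde lam) (betaTilde lam) m = tridiag (alphaTilde lam) (betaTilde lam) m) ∧
    -- the polynomials: monic, generated by the recurrence, and orthogonal
    ((∀ k : ℕ, (polyP (alpha lam) (beta lam) k).Monic ∧
        (polyP (alpha lam) (beta lam) k).natDegree = k) ∧
      SatisfiesRecurrence (alpha lam) (beta lam) (polyP (alpha lam) (beta lam)) ∧
      OrthogonalOnHalfLine (polyP (alpha lam) (beta lam))) ∧
    ((∀ k : ℕ, (polyP (alphaTilde lam) (betaTilde lam) k).Monic ∧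
        (polyP (alphaTilde lam) (betaTilde lam) k).natDegree = k) ∧
      SatisfiesRecurrence (alphaTilde lam) (betaTilde lam)
        (polyP (alphaTilde lam) (betaTilde lam)) ∧
      OrthogonalOnHalfLine (polyP (alphaTilde lam) (betaTilde lam))) := by
  have ha := alpha_ne_zero hlam
  have hb := beta_ne_zero hlam
  have ha' := alphaTilde_ne_zero hlam
  have hb' := betaTilde_ne_zero hlam
  exact ⟨fun m hm => markovConst_even hlam hm, fun m hm => markovConst_odd hlam hm,
    fun m => ⟨isUnit_det_matA ha hb m, matB_posDef ha hb m, matB_eq_tridiag ha hb m⟩,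
    fun m => ⟨isUnit_det_matA ha' hb' m, matB_posDef ha' hb' m, matB_eq_tridiag ha' hb' m⟩,
    ⟨fun k => ⟨polyP_monic _ _ k, polyP_natDegree _ _ k⟩, polyP_recurrence ha hb,
      orthogonalOnHalfLine_polyP_alpha_beta hlam⟩,
    ⟨fun k => ⟨polyP_monic _ _ k, polyP_natDegree _ _ k⟩, polyP_recurrence ha' hb',
      orthogonalOnHalfLine_polyP_alphaTilde_betaTilde hlam⟩⟩
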